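/- Let $d\ge1$ be an integer and $M>0$ a real number. For $n\ge1$ let $\mathcal M_{d,n}$ be the set of real $d\times n$ matrices whose positive singular values are pairwise distinct (the singular value $0$ may have any multiplicity). Let $Z\in\mathcal M_{d,n}$, $\dot Z\in\mathbb R^{d\times n}$, let $\xi_1>\dots>\xi_k>0$ be the positive singular values of $Z$, and let ${}^*$ denote transposition. Let $\mathbf u_1,\dots,\mathbf u_k\in\mathbb R^d$ and $\mathbf v_1,\dots,\mathbf v_k\in\mathbb R^n$ be unit eigenvectors of $ZZ^*$ and $Z^*Z$ for the eigenvalues $\xi_1^2,\dots,\xi_k^2$ (determined up to sign). Let $\dot{\mathbf u}_i$ and $\dot{\mathbf v}_i$ be their derivatives at $t=0$ when they are continued as continuous unit eigenvectors of $\mathfrak Z(t)\mathfrak Z(t)^*$ and $\mathfrak Z(t)^*\mathfrak Z(t)$ along an arbitrary curve of matrices $\mathfrak Z(t)$ with $\mathfrak Z(0)=Z$, $\frac{d\mathfrak Z}{dt}(0)=\dot Z$. Let $\mathbf a_i$ and $\mathbf b_i$ be the orthogonal projections of $\dot{\mathbf u}_i$ and $\dot{\mathbf v}_i$ onto $\ker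 ZZ^*$ and $\ker Z^*Z$. Put \[ E_{out}^A=\frac M2\sum_{i=1}^k\xi_i^2\sum_{j=1}^k(\mathbf u_j\cdot\dot{\mathbf u}_i)^2,\quad E_{out}^B=\frac M2\sum_{i=1}^k\xi_i^2|\mathbf a_i|^2,\quad E_{in}^A=\frac M2\sum_{i=1}^k\xi_i^2\sum_{j=1}^k(\mathbf v_j\cdot\dot{\mathbf v}_i)^2,\quad E_{in}^B=\frac M2\sum_{i=1}^k\xi_i^2|\mathbf b_i|^2 . \] Let $\|\cdot\|$ be the Frobenius norm, and let $\mathfrak{so}(m)$ be the space of skew-symmetric $m\times m$ matrices. Let $Z^{rot}$ be the Frobenius-orthogonal projection of $\dot Z$ onto $\mathfrak{so}(d)Z+Z\mathfrak{so}(n)$, let $Z^{rot}=Z^{out}+Z^{in}$ with $Z^{out}\in\mathfrak{so}(d)Z$, $Z^{in}\in Z\mathfrak{so}(n)$, and put $T_{rot}=\frac M2\|Z^{rot}\|^2$, $E_{out}=\frac M2\|Z^{out}\|^2$, $E_{in}=\frac M2\|Z^{in}\|^2$. Then, for all $n\ge1$, $Z\in\mathcal M_{d,n}$ and $\dot Z\in\mathbb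 R^{d\times n}$: (0) All these quantities are well defined: the derivatives $\dot{\mathbf u}_i,\dot{\mathbf v}_i$ exist and do not depend on the curve, the decomposition $Z^{rot}=Z^{out}+Z^{in}$ exists and is unique, and the four energies do not depend on the choice of the signs of the eigenvectors. (1) Each of the four functions $f\in\{E_{out}^A,E_{out}^B,E_{in}^A,E_{in}^B\}$ is an instantaneous phase-space invariant: for all $R\in\mathrm O(d)$, $Q\in\mathrm O(n)$ one has $RZQ^*\in\mathcal M_{d,n}$ and $f(RZQ^*,R\dot ZQ^*)=f(Z,\dot Z)$; and, when a zero column is appended, $(Z\;0)\in\mathcal M_{d,n+1}$ and $f\bigl((Z\;0),(\dot Z\;0)\bigr)=f(Z,\dot Z)$. (2) $E_{out}=E_{out}^A+E_{out}^B$ and $E_{in}=E_{in}^A+E_{in}^B$. (3) $E_{out}^B\le T_{rot}$ and $E_{in}^B\le T_{rot}$. -/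

import Mathlib

open scoped Matrix Topology

namespace PhaseSpace

noncomputable section

/-- The `d × (n+1)` matrix `(Z 0)` obtained from `Z` by appending a last column equal to zero. -/
def appendZeroColumn {d n : ℕ} (Z : Matrix (Fin d) (Fin n) ℝ) : Matrix (Fin d) (Fin (n + 1)) ℝ :=
  Matrix.of fun i => Fin.snoc (α := fun _ => ℝ) (Z i) 0

/-- A collection of functions `f n`, defined on `dom n × ℝ^{d × n}` for `n ≥ n₀`, is an
instantaneous phase-space invariant of systems of classical particles in `ℝ^d`.
(Values of `f n` outside the domain play no role.) -/
structure IsInstantaneousPhaseSpaceInvariant (d n₀ : ℕ)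
    (dom : ∀ n : ℕ, Set (Matrix (Fin d) (Fin n) ℝ))
    (f : ∀ n : ℕ, Matrix (Fin d) (Fin n) ℝ → Matrix (Fin d) (Fin n) ℝ → ℝ) : Prop where
  orthogonal_mem : ∀ n, n₀ ≤ n → ∀ Z ∈ dom n,
    ∀ R ∈ Matrix.orthogonalGroup (Fin d) ℝ, ∀ Q ∈ Matrix.orthogonalGroup (Fin n) ℝ,
      R * Z * Qᵀ ∈ dom n
  orthogonal_eq : ∀ n, n₀ ≤ n → ∀ Z ∈ dom n, ∀ Z' : Matrix (Fin d) (Fin n) ℝ,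
    ∀ R ∈ Matrix.orthogonalGroup (Fin d) ℝ, ∀ Q ∈ Matrix.orthogonalGroup (Fin n) ℝ,
      f n (R * Z * Qᵀ) (R * Z' * Qᵀ) = f n Z Z'
  append_mem : ∀ n, n₀ ≤ n → ∀ Z ∈ dom n, appendZeroColumn Z ∈ dom (n + 1)
  append_eq : ∀ n, n₀ ≤ n → ∀ Z ∈ dom n, ∀ Z' : Matrix (Fin d) (Fin n) ℝ,
    f (n + 1) (appendZeroColumn Z) (appendZeroColumn Z') = f n Z Z'

section SingularValues

variable {d n : ℕ}

/-- The singular values of `Z` in decreasing order, numbered from `0` and continued by zeros. -/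
def sval (Z : Matrix (Fin d) (Fin n) ℝ) (i : ℕ) : ℝ :=
  (Matrix.toEuclideanLin Z).singularValues i

/-- The number `k` of positive singular values of `Z` (counted with multiplicity). -/
def numPos (Z : Matrix (Fin d) (Fin n) ℝ) : ℕ :=
  (Matrix.toEuclideanLin Z).singularValues.support.card

end SingularValues

/-- The set of the `d × n` matrices whose positive singular values are pairwise distinct
(the singular value zero may have any multiplicity). -/
def distinctDomain (d n : ℕ) : Set (Matrix (Fin d) (Fin n) ℝ) :=
  {Z | ∀ i j : ℕ, 0 < sval Z i → sval Z i = sval Z j → i = j}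

section Rotational

variable {d n : ℕ}

/-- Matrices as vectors of the Euclidean space `ℝ^{dn}`, so that the inner product and the norm
become the Frobenius ones. -/
def frob : Matrix (Fin d) (Fin n) ℝ ≃ₗ[ℝ] EuclideanSpace ℝ (Fin d × Fin n) :=
  (LinearEquiv.curry ℝ ℝ (Fin d) (Fin n)).symm ≪≫ₗ
    (WithLp.linearEquiv 2 ℝ (Fin d × Fin n → ℝ)).symm

/-- The direction space of the tangent plane at `Z` to `{R Z | R ∈ SO(d)}`. -/
def outerTangent (Z : Matrix (Fin d) (Fin n) ℝ) : Submodule ℝ (Matrix (Fin d) (Fin n) ℝ) where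
  carrier := {A | ∃ S ∈ LieAlgebra.Orthogonal.so (Fin d) ℝ, A = S * Z}
  zero_mem' := ⟨0, zero_mem _, by simp⟩
  add_mem' := by
    rintro _ _ ⟨S, hS, rfl⟩ ⟨S', hS', rfl⟩
    exact ⟨S + S', add_mem hS hS', by rw [Matrix.add_mul]⟩
  smul_mem' := by
    rintro c _ ⟨S, hS, rfl⟩
    exact ⟨c • S, SMulMemClass.smul_mem c hS, by rw [Matrix.smul_mul]⟩

/-- The direction space of the tangent plane at `Z` to `{Z Q | Q ∈ SO(n)}`. -/
def innerTangent (Z : Matrix (Fin d) (Fin n) ℝ) : Submodule ℝ (Matrix (Fin d) (Fin n) ℝ) where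
  carrier := {A | ∃ S ∈ LieAlgebra.Orthogonal.so (Fin n) ℝ, A = Z * S}
  zero_mem' := ⟨0, zero_mem _, by simp⟩
  add_mem' := by
    rintro _ _ ⟨S, hS, rfl⟩ ⟨S', hS', rfl⟩
    exact ⟨S + S', add_mem hS hS', by rw [Matrix.mul_add]⟩
  smul_mem' := by
    rintro c _ ⟨S, hS, rfl⟩
    exact ⟨c • S, SMulMemClass.smul_mem c hS, by rw [Matrix.mul_smul]⟩

/-- The rotational component of `Z'`: the Frobenius-orthogonal projection of `Z'` onto the direction
space `{S Z + Z S'}` of the tangent plane at `Z` to `{R Z Q | R ∈ SO(d), Q ∈ SO(n)}`. -/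
def rotPart (Z Z' : Matrix (Fin d) (Fin n) ℝ) : Matrix (Fin d) (Fin n) ℝ :=
  frob.symm
    (((outerTangent Z ⊔ innerTangent Z).map
      (frob (d := d) (n := n)).toLinearMap).starProjection (frob Z'))

/-- The rotational energy. -/
def Trot (M : ℝ) (Z Z' : Matrix (Fin d) (Fin n) ℝ) : ℝ :=
  M / 2 * ‖frob (rotPart Z Z')‖ ^ 2

/-- `P = (Zout, Zin)` is a decomposition `Zrot = Zout + Zin` of the rotational component into
an outer and an inner tangent component. -/
def IsSingularDecomposition (Z Z' : Matrix (Fin d) (Fin n) ℝ)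
    (P : Matrix (Fin d) (Fin n) ℝ × Matrix (Fin d) (Fin n) ℝ) : Prop :=
  P.1 ∈ outerTangent Z ∧ P.2 ∈ innerTangent Z ∧ rotPart Z Z' = P.1 + P.2

/-- The pair `(Zout, Zin)` (unique if the positive singular values of `Z` are distinct). -/
def singularDecomposition (Z Z' : Matrix (Fin d) (Fin n) ℝ) :
    Matrix (Fin d) (Fin n) ℝ × Matrix (Fin d) (Fin n) ℝ :=
  Classical.epsilon (IsSingularDecomposition Z Z')

/-- The tangent external energy (outer term). -/
def Eout (M : ℝ) (Z Z' : Matrix (Fin d) (Fin n) ℝ) : ℝ :=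
  M / 2 * ‖frob (singularDecomposition Z Z').1‖ ^ 2

/-- The tangent internal energy (inner term). -/
def Ein (M : ℝ) (Z Z' : Matrix (Fin d) (Fin n) ℝ) : ℝ :=
  M / 2 * ‖frob (singularDecomposition Z Z').2‖ ^ 2

end Rotational

section Eigenvectors

variable {d n m k : ℕ}

/-- `c` is a curve of matrices with `c 0 = Z` and `c' 0 = Z'`. -/
def IsMotion (Z Z' : Matrix (Fin d) (Fin n) ℝ) (c : ℝ → Matrix (Fin d) (Fin n) ℝ) : Prop :=
  c 0 = Z ∧ ∀ i j, HasDerivAt (fun t => c t i j) (Z' i j) 0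

/-- Near `t = 0`, `x t` is a unit eigenvector of the matrix `G t`; `x` is continuous at `0` and
`x 0 = u`. -/
def IsEigenBranch (G : ℝ → Matrix (Fin m) (Fin m) ℝ) (u : EuclideanSpace ℝ (Fin m))
    (x : ℝ → EuclideanSpace ℝ (Fin m)) : Prop :=
  x 0 = u ∧ ContinuousAt x 0 ∧
    ∀ᶠ t in 𝓝 (0 : ℝ), ‖x t‖ = 1 ∧ ∃ μ : ℝ, Matrix.toEuclideanLin (G t) (x t) = μ • x t

/-- `w` is the dot derivative at `(Z, Z')` of the unit eigenvector `u` of the matrix `gram Z`: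
along every curve `c` through `Z` with velocity `Z'`, the eigenvector `u` extends to a continuous
family of unit eigenvectors of `gram (c t)`, and every such family has derivative `w` at `t = 0`. -/
def IsEigenvectorDot (gram : Matrix (Fin d) (Fin n) ℝ → Matrix (Fin m) (Fin m) ℝ)
    (Z Z' : Matrix (Fin d) (Fin n) ℝ) (u w : EuclideanSpace ℝ (Fin m)) : Prop :=
  ∀ c, IsMotion Z Z' c →
    (∃ x, IsEigenBranch (fun t => gram (c t)) u x) ∧
      ∀ x, IsEigenBranch (fun t => gram (c t)) u x → HasDerivAt x w 0

/-- `p.1` is a list of unit eigenvectors of `gram Z` corresponding to the eigenvalues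
`ξ_1^2, …, ξ_k^2`, the squares of the positive singular values of `Z`, and `p.2` is the list of
their dot derivatives. -/
def IsEigenSystem (gram : Matrix (Fin d) (Fin n) ℝ → Matrix (Fin m) (Fin m) ℝ)
    (Z Z' : Matrix (Fin d) (Fin n) ℝ)
    (p : (Fin (numPos Z) → EuclideanSpace ℝ (Fin m)) ×
      (Fin (numPos Z) → EuclideanSpace ℝ (Fin m))) : Prop :=
  ∀ i : Fin (numPos Z), ‖p.1 i‖ = 1 ∧
    Matrix.toEuclideanLin (gram Z) (p.1 i) = (sval Z i ^ 2) • p.1 i ∧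
    IsEigenvectorDot gram Z Z' (p.1 i) (p.2 i)

/-- A choice of the eigenvectors and their dot derivatives. -/
def eigenSystem (gram : Matrix (Fin d) (Fin n) ℝ → Matrix (Fin m) (Fin m) ℝ)
    (Z Z' : Matrix (Fin d) (Fin n) ℝ) :
    (Fin (numPos Z) → EuclideanSpace ℝ (Fin m)) × (Fin (numPos Z) → EuclideanSpace ℝ (Fin m)) :=
  Classical.epsilon (IsEigenSystem gram Z Z')

/-- `(M/2) ∑ ξ_i^2 ∑ (u_j · w_i)^2`. -/
def energyA (M : ℝ) (ξ : Fin k → ℝ)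
    (p : (Fin k → EuclideanSpace ℝ (Fin m)) × (Fin k → EuclideanSpace ℝ (Fin m))) : ℝ :=
  M / 2 * ∑ i, ξ i ^ 2 * ∑ j, (inner ℝ (p.1 j) (p.2 i)) ^ 2

/-- `(M/2) ∑ ξ_i^2 |a_i|^2`, where `a_i` is the orthogonal projection of `w_i` onto the
zero subspace of the matrix `G`. -/
def energyB (M : ℝ) (ξ : Fin k → ℝ) (G : Matrix (Fin m) (Fin m) ℝ)
    (p : (Fin k → EuclideanSpace ℝ (Fin m)) × (Fin k → EuclideanSpace ℝ (Fin m))) : ℝ :=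
  M / 2 * ∑ i, ξ i ^ 2 * ‖(LinearMap.ker (Matrix.toEuclideanLin G)).starProjection (p.2 i)‖ ^ 2

/-- `Z ↦ Z Zᵀ`. -/
def gramL (Z : Matrix (Fin d) (Fin n) ℝ) : Matrix (Fin d) (Fin d) ℝ := Z * Zᵀ

/-- `Z ↦ Zᵀ Z`. -/
def gramR (Z : Matrix (Fin d) (Fin n) ℝ) : Matrix (Fin n) (Fin n) ℝ := Zᵀ * Z

/-- The unbounded component of the outer term. -/
def EoutA (M : ℝ) (Z Z' : Matrix (Fin d) (Fin n) ℝ) : ℝ :=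
  energyA M (fun i : Fin (numPos Z) => sval Z i) (eigenSystem gramL Z Z')

/-- The bounded component of the outer term. -/
def EoutB (M : ℝ) (Z Z' : Matrix (Fin d) (Fin n) ℝ) : ℝ :=
  energyB M (fun i : Fin (numPos Z) => sval Z i) (gramL Z) (eigenSystem gramL Z Z')

/-- The unbounded component of the inner term. -/
def EinA (M : ℝ) (Z Z' : Matrix (Fin d) (Fin n) ℝ) : ℝ :=
  energyA M (fun i : Fin (numPos Z) => sval Z i) (eigenSystem gramR Z Z')

/-- The bounded component of the inner term. -/
def EinB (M : ℝ) (Z Z' : Matrix (Fin d) (Fin n) ℝ) : ℝ :=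
  energyB M (fun i : Fin (numPos Z) => sval Z i) (gramR Z) (eigenSystem gramR Z Z')

/-- The quantities entering the definitions of the energies at `(Z, Z')` exist, and the energies do
not depend on the choices made. -/
structure EnergiesWellDefined (M : ℝ) (Z Z' : Matrix (Fin d) (Fin n) ℝ) : Prop where
  outer_exists : ∃ p, IsEigenSystem gramL Z Z' p
  outer_eq : ∀ p, IsEigenSystem gramL Z Z' p →
    EoutA M Z Z' = energyA M (fun i : Fin (numPos Z) => sval Z i) p ∧
    EoutB M Z Z' = energyB M (fun i : Fin (numPos Z) => sval Z i) (gramL Z) p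
  inner_exists : ∃ p, IsEigenSystem gramR Z Z' p
  inner_eq : ∀ p, IsEigenSystem gramR Z Z' p →
    EinA M Z Z' = energyA M (fun i : Fin (numPos Z) => sval Z i) p ∧
    EinB M Z Z' = energyB M (fun i : Fin (numPos Z) => sval Z i) (gramR Z) p
  decomposition : ∃! P, IsSingularDecomposition Z Z' P

end Eigenvectors

end

end PhaseSpace

open PhaseSpace

/-! Fix a singular value decomposition: orthonormal bases u, v with Z v_i = ξ_i u_i for i ≤ k, the
remaining vectors spanning the kernels. Put x_ab = u_a · Z' v_b. Every energy becomes an explicit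
function of ξ and x.

Perturbation of a simple eigenvalue gives u_j · u̇_i = (ξ_j x_ij + ξ_i x_ji) / (ξ_i² - ξ_j²) for j ≠
i, and u_a · u̇_i = x_ai / ξ_i for kernel vectors u_a (`hasDerivAt_eigenvector`). Only the sign of
u_i is arbitrary, and it is squared away (`IsEigenFrame.exists_sign`). Transposing Z exchanges u and
v.

A matrix S Z with S skew has entries ξ_j s_aj with s skew, and zero kernel columns; Z S is dual to
this. The outer and inner spaces meet only in 0, since the entries (i,j) and (j,i) obey a 2×2 system
of determinant ±(ξ_i² - ξ_j²) (`IsSVD.disjoint_tangent`). The projection erases the diagonal of the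
k×k block and the kernel-kernel block, where all tangent matrices vanish, and keeps the rest
(`IsSVD.exists_singularDecomposition`). Solving the systems yields s_aj = u_a · u̇_j, so Z^out = ∑
ξ_j u̇_j v_jᵀ and Z^in = ∑ ξ_i u_i v̇_iᵀ. Their squared norms split into the A and B energies.

The B energies are M/2 times the sums of x_ai² and of x_ib², taken over disjoint blocks of entries
of Z^rot, hence at most the rotational energy. The bases R u, Q v decompose R Z Qᵀ with the same ξ
and x, and a zero column adds one kernel vector with zero entries of x; this is the invariance. -/

namespace PhaseSpace

/-! ### First-order perturbation of simple eigenvalues -/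

section Perturbation

open Filter

variable {ι E : Type*} [Fintype ι] [NormedAddCommGroup E] [InnerProductSpace ℝ E]
  {w : OrthonormalBasis ι ℝ E} {G : ℝ → E →ₗ[ℝ] E} {lam : ι → ℝ} {H : ι → E} {j₀ : ι}

theorem sum_inner_sq_eq_one (w : OrthonormalBasis ι ℝ E) {x : E} (hx : ‖x‖ = 1) :
    ∑ j, (inner ℝ (w j) x) ^ 2 = 1 := by
  rw [w.sum_sq_inner_right, hx, one_pow]

/-- Symmetry moves T onto v. When v is nearly an eigenvector for a, the right side is small; all
limits and derivatives of eigenvectors below come from this identity, without differentiating the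
eigenvalue. -/
theorem sub_mul_inner_eq_of_eigenvector {T : E →ₗ[ℝ] E} (hT : T.IsSymmetric) {x : E} {μ : ℝ}
    (hx : T x = μ • x) (a : ℝ) (v : E) :
    (μ - a) * inner ℝ v x = inner ℝ (T v - a • v) x := by
  rw [inner_sub_left, hT, hx, inner_smul_left, inner_smul_right]
  simp
  ring

/-- Pigeonhole: the squared coordinates of v in an eigenbasis of T sum to 1, so one of them is at
least the average; the sign of that eigenvector is then adjusted. The bound does not depend on T,
hence is uniform along a curve. -/
theorem exists_unit_eigenvector_inner_ge [DecidableEq ι] {T : E →ₗ[ℝ] E} (hT : T.IsSymmetric)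
    (w : OrthonormalBasis ι ℝ E) {v : E} (hv : ‖v‖ = 1) :
    ∃ (x : E) (μ : ℝ), ‖x‖ = 1 ∧ T x = μ • x ∧ √((Fintype.card ι : ℝ)⁻¹) ≤ inner ℝ v x := by
  have : FiniteDimensional ℝ E := w.toBasis.finiteDimensional_of_finite
  set b := hT.eigenvectorBasis (Module.finrank_eq_card_basis w.toBasis)
  have hs : ∑ j, (inner ℝ (b j) v) ^ 2 = 1 := sum_inner_sq_eq_one b hv
  obtain ⟨j, -, hj⟩ : ∃ j ∈ (Finset.univ : Finset (Fin (Fintype.card ι))),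
      (Fintype.card ι : ℝ)⁻¹ ≤ (inner ℝ (b j) v) ^ 2 := by
    by_contra! hlt
    have hne : (Finset.univ : Finset (Fin (Fintype.card ι))).Nonempty := by
      by_contra hne
      rw [Finset.not_nonempty_iff_eq_empty] at hne
      rw [hne] at hs
      simp at hs
    have := Finset.sum_lt_sum_of_nonempty hne hlt
    have hc : (Fintype.card ι : ℝ) ≠ 0 := by
      obtain ⟨i, -⟩ := hne
      have := i.pos
      positivity
    rw [hs] at this
    simp [hc] at this
  have hle : √((Fintype.card ι : ℝ)⁻¹) ≤ |inner ℝ v (b j)| := by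
    rw [real_inner_comm, ← Real.sqrt_sq_eq_abs]
    exact Real.sqrt_le_sqrt hj
  have hbj : T (b j) = hT.eigenvalues (Module.finrank_eq_card_basis w.toBasis) j • b j :=
    hT.apply_eigenvectorBasis _ j
  rcases le_total 0 (inner ℝ v (b j)) with h | h
  · exact ⟨b j, _, by simp, hbj, by rwa [abs_of_nonneg h] at hle⟩
  · refine ⟨-b j, _, by simp, by rw [map_neg, hbj, smul_neg], ?_⟩
    rwa [abs_of_nonpos h, ← inner_neg_right] at hle

/-- The product (μ t - a) ⟨v, x t⟩ tends to 0 while its first factor tends to a nonzero limit. -/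
theorem tendsto_inner_eigenvector {l : Filter ℝ} {x : ℝ → E} {μ : ℝ → ℝ} {a a₀ : ℝ} {v : E}
    (hsymm : ∀ t, (G t).IsSymmetric) (hv : Tendsto (fun t => G t v) l (𝓝 (a • v)))
    (hx : ∀ᶠ t in l, ‖x t‖ = 1 ∧ G t (x t) = μ t • x t) (ha : a ≠ a₀)
    (hμ : Tendsto μ l (𝓝 a₀)) :
    Tendsto (fun t => inner ℝ v (x t)) l (𝓝 0) := by
  have h1 : Tendsto (fun t => inner ℝ (G t v - a • v) (x t)) l (𝓝 0) := by
    refine squeeze_zero_norm' (a := fun t => ‖G t v - a • v‖) ?_ ?_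
    · filter_upwards [hx] with t ht
      simpa [ht.1] using norm_inner_le_norm (𝕜 := ℝ) (G t v - a • v) (x t)
    · simpa using (hv.sub_const (a • v)).norm
  have h2 : Tendsto (fun t => μ t - a) l (𝓝 (a₀ - a)) := hμ.sub_const a
  have h3 := h1.div h2 (sub_ne_zero.2 ha.symm)
  rw [zero_div] at h3
  refine h3.congr' ?_
  filter_upwards [hx, h2.eventually_ne (sub_ne_zero.2 ha.symm)] with t ht hne
  rw [Pi.div_apply, ← sub_mul_inner_eq_of_eigenvector (hsymm t) ht.2, mul_div_cancel_left₀ _ hne]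

/-- The same identity read the other way: an overlap of at least δ gives |μ t - a| δ ≤ ‖G t v - a
v‖. -/
theorem tendsto_eigenvalue {l : Filter ℝ} {x : ℝ → E} {μ : ℝ → ℝ} {a δ : ℝ} {v : E}
    (hsymm : ∀ t, (G t).IsSymmetric) (hv : Tendsto (fun t => G t v) l (𝓝 (a • v)))
    (hx : ∀ᶠ t in l, ‖x t‖ = 1 ∧ G t (x t) = μ t • x t) (hδ : 0 < δ)
    (hge : ∀ᶠ t in l, δ ≤ inner ℝ v (x t)) :
    Tendsto μ l (𝓝 a) := by
  rw [tendsto_iff_norm_sub_tendsto_zero]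
  have h1 : Tendsto (fun t => ‖G t v - a • v‖ / δ) l (𝓝 0) := by
    simpa using ((hv.sub_const (a • v)).norm).div_const δ
  refine squeeze_zero' (Eventually.of_forall fun t => norm_nonneg _) ?_ h1
  filter_upwards [hx, hge] with t ht hg
  rw [le_div_iff₀ hδ]
  calc ‖μ t - a‖ * δ ≤ ‖μ t - a‖ * ‖inner ℝ v (x t)‖ := by
        gcongr
        exact hg.trans (le_abs_self _)
    _ = ‖inner ℝ (G t v - a • v) (x t)‖ := by
        rw [← norm_mul, sub_mul_inner_eq_of_eigenvector (hsymm t) ht.2]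
    _ ≤ ‖G t v - a • v‖ := by
        simpa [ht.1] using norm_inner_le_norm (𝕜 := ℝ) (G t v - a • v) (x t)

theorem inner_eq_sqrt_of_pos [DecidableEq ι] (w : OrthonormalBasis ι ℝ E) {x : E} (hx : ‖x‖ = 1)
    (hpos : 0 ≤ inner ℝ (w j₀) x) :
    inner ℝ (w j₀) x = √(1 - ∑ j ∈ Finset.univ.erase j₀, (inner ℝ (w j) x) ^ 2) := by
  rw [← sum_inner_sq_eq_one w hx, ← Finset.add_sum_erase _ _ (Finset.mem_univ j₀),
    add_sub_cancel_right, Real.sqrt_sq hpos]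

/-- A unit eigenvector for a simple eigenvalue of a symmetric operator extends to a family of unit
eigenvectors along any symmetric perturbation, continuous at the base point. -/
theorem exists_eigenvector_continuousAt [DecidableEq ι] (hsymm : ∀ t, (G t).IsSymmetric)
    (h0 : ∀ j, G 0 (w j) = lam j • w j) (hG : ∀ j, ContinuousAt (fun t => G t (w j)) 0)
    (hsimple : ∀ j, j ≠ j₀ → lam j ≠ lam j₀) :
    ∃ x : ℝ → E, x 0 = w j₀ ∧ ContinuousAt x 0 ∧
      ∀ t, ‖x t‖ = 1 ∧ ∃ μ : ℝ, G t (x t) = μ • x t := by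
  have hG' : ∀ j, Tendsto (fun t => G t (w j)) (𝓝 0) (𝓝 (lam j • w j)) := fun j => by
    simpa only [ContinuousAt, h0] using hG j
  -- The eigenvectors are picked independently for each t; the uniform overlap with w j₀ alone
  -- forces convergence at 0.
  choose y μ hy1 hyμ hyge using fun t =>
    exists_unit_eigenvector_inner_ge (hsymm t) w (v := w j₀) (by simp)
  have hδ : 0 < √((Fintype.card ι : ℝ)⁻¹) := by
    have : 0 < Fintype.card ι := Fintype.card_pos_iff.2 ⟨j₀⟩
    positivity
  have hy : ∀ᶠ t in 𝓝 (0 : ℝ), ‖y t‖ = 1 ∧ G t (y t) = μ t • y t :=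
    Eventually.of_forall fun t => ⟨hy1 t, hyμ t⟩
  have hμ : Tendsto μ (𝓝 0) (𝓝 (lam j₀)) :=
    tendsto_eigenvalue hsymm (hG' j₀) hy hδ (Eventually.of_forall hyge)
  have hcoord : ∀ j, j ≠ j₀ → Tendsto (fun t => inner ℝ (w j) (y t)) (𝓝 0) (𝓝 0) := fun j hj =>
    tendsto_inner_eigenvector hsymm (hG' j) hy (hsimple j hj) hμ
  have hmain : Tendsto (fun t => inner ℝ (w j₀) (y t)) (𝓝 0) (𝓝 1) := by
    have : Tendsto (fun t => √(1 - ∑ j ∈ Finset.univ.erase j₀, (inner ℝ (w j) (y t)) ^ 2))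
        (𝓝 0) (𝓝 √(1 - ∑ j ∈ Finset.univ.erase j₀, (0 : ℝ) ^ 2)) :=
      (tendsto_const_nhds.sub (tendsto_finsetSum _ fun j hj =>
        (hcoord j (Finset.ne_of_mem_erase hj)).pow 2)).sqrt
    simp only [ne_eq, OfNat.ofNat_ne_zero, not_false_eq_true, zero_pow, Finset.sum_const_zero,
      sub_zero, Real.sqrt_one] at this
    exact this.congr fun t => (inner_eq_sqrt_of_pos w (hy1 t) (hδ.le.trans (hyge t))).symm
  have hlim : Tendsto y (𝓝 0) (𝓝 (w j₀)) := by
    have h1 : Tendsto (fun t => ∑ j, inner ℝ (w j) (y t) • w j) (𝓝 0)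
        (𝓝 (∑ j, (if j = j₀ then (1 : ℝ) else 0) • w j)) := by
      refine tendsto_finsetSum _ fun j _ => Tendsto.smul_const ?_ _
      by_cases hj : j = j₀
      · simpa [hj] using hmain
      · simpa [hj] using hcoord j hj
    simpa [w.sum_repr'] using h1
  refine ⟨Function.update y 0 (w j₀), by simp, ?_, fun t => ?_⟩
  · rw [continuousAt_update_same]
    exact hlim.mono_left nhdsWithin_le_nhds
  · by_cases ht : t = 0
    · subst ht
      exact ⟨by simp, lam j₀, by simpa using h0 j₀⟩
    · simpa [ht] using ⟨hy1 t, μ t, hyμ t⟩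

/-- First order perturbation of a unit eigenvector for a simple eigenvalue. -/
theorem hasDerivAt_eigenvector [DecidableEq ι] (hsymm : ∀ t, (G t).IsSymmetric)
    (h0 : ∀ j, G 0 (w j) = lam j • w j) (hG : ∀ j, HasDerivAt (fun t => G t (w j)) (H j) 0)
    (hsimple : ∀ j, j ≠ j₀ → lam j ≠ lam j₀) {x : ℝ → E} (hx0 : x 0 = w j₀)
    (hxc : ContinuousAt x 0) (hx : ∀ᶠ t in 𝓝 (0 : ℝ), ‖x t‖ = 1 ∧ ∃ μ : ℝ, G t (x t) = μ • x t) :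
    HasDerivAt x (∑ j, (inner ℝ (H j) (w j₀) / (lam j₀ - lam j)) • w j) 0 := by
  obtain ⟨μ, hxμ⟩ : ∃ μ : ℝ → ℝ, ∀ᶠ t in 𝓝 (0 : ℝ), ‖x t‖ = 1 ∧ G t (x t) = μ t • x t := by
    classical
    -- The default value 0 is harmless, as eigenvalues are only used for t near 0.
    refine ⟨fun t => if h : ∃ μ : ℝ, G t (x t) = μ • x t then h.choose else 0, ?_⟩
    filter_upwards [hx] with t ht
    refine ⟨ht.1, ?_⟩
    rw [dif_pos ht.2]
    exact ht.2.choose_spec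
  have hG' : ∀ j, Tendsto (fun t => G t (w j)) (𝓝 0) (𝓝 (lam j • w j)) := fun j => by
    simpa only [ContinuousAt, h0] using (hG j).continuousAt
  have hx' : Tendsto x (𝓝 0) (𝓝 (w j₀)) := by simpa only [ContinuousAt, hx0] using hxc
  have hc : Tendsto (fun t => inner ℝ (w j₀) (x t)) (𝓝 0) (𝓝 1) := by
    simpa using Filter.Tendsto.inner (𝕜 := ℝ) (tendsto_const_nhds (x := w j₀)) hx'
  have hge : ∀ᶠ t in 𝓝 (0 : ℝ), (1 / 2 : ℝ) ≤ inner ℝ (w j₀) (x t) :=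
    (hc.eventually_const_lt (by norm_num)).mono fun t ht => ht.le
  have hμ : Tendsto μ (𝓝 0) (𝓝 (lam j₀)) :=
    tendsto_eigenvalue hsymm (hG' j₀) hxμ (by norm_num) hge
  have hcoord : ∀ j, j ≠ j₀ → HasDerivAt (fun t => inner ℝ (w j) (x t))
      (inner ℝ (H j) (w j₀) / (lam j₀ - lam j)) 0 := by
    intro j hj
    have hne : lam j₀ - lam j ≠ 0 := sub_ne_zero.2 (hsimple j hj).symm
    rw [hasDerivAt_iff_tendsto_slope_zero]
    have h1 := Filter.Tendsto.inner (𝕜 := ℝ) (hasDerivAt_iff_tendsto_slope_zero.1 (hG j))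
      (hx'.mono_left (nhdsWithin_le_nhds (s := {0}ᶜ)))
    have h2 : Tendsto (fun t => μ t - lam j) (𝓝[≠] 0) (𝓝 (lam j₀ - lam j)) :=
      (hμ.sub_const _).mono_left nhdsWithin_le_nhds
    -- The difference quotient of ⟨w j, x t⟩ equals ⟨(G t (w j) - G 0 (w j)) / t, x t⟩ / (μ t - lam
    -- j), so continuity of x at 0 suffices.
    refine (h1.div h2 hne).congr' ?_
    filter_upwards [h2.eventually_ne hne, hxμ.filter_mono nhdsWithin_le_nhds] with t ht hxt
    simp only [zero_add, hx0, h0, w.inner_eq_zero hj, sub_zero, smul_eq_mul]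
    rw [Pi.div_apply, inner_smul_left, ← sub_mul_inner_eq_of_eigenvector (hsymm t) hxt.2]
    simp
    field_simp
  -- Near 0 this coordinate is the square root of 1 minus the squares of the others, which all
  -- vanish at 0.
  have hmain : HasDerivAt (fun t => inner ℝ (w j₀) (x t)) 0 0 := by
    have h1 : HasDerivAt (fun t => 1 - ∑ j ∈ Finset.univ.erase j₀, (inner ℝ (w j) (x t)) ^ 2)
        0 0 := by
      have h2 := (HasDerivAt.fun_sum (u := Finset.univ.erase j₀) fun j hj =>
        (hcoord j (Finset.ne_of_mem_erase hj)).fun_pow 2).const_sub 1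
      refine h2.congr_deriv ?_
      rw [neg_eq_zero]
      refine Finset.sum_eq_zero fun j hj => ?_
      simp [hx0, w.inner_eq_zero (Finset.ne_of_mem_erase hj)]
    have h3 : (1 - ∑ j ∈ Finset.univ.erase j₀, (inner ℝ (w j) (x 0)) ^ 2) = 1 := by
      rw [sub_eq_self]
      refine Finset.sum_eq_zero fun j hj => ?_
      simp [hx0, w.inner_eq_zero (Finset.ne_of_mem_erase hj)]
    have h4 := h1.sqrt (by rw [h3]; norm_num)
    rw [zero_div] at h4
    refine h4.congr_of_eventuallyEq ?_
    filter_upwards [hge, hxμ] with t ht hxt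
    exact inner_eq_sqrt_of_pos w hxt.1 (le_trans (by norm_num) ht)
  have hsum : HasDerivAt (fun t => ∑ j, inner ℝ (w j) (x t) • w j)
      (∑ j, (inner ℝ (H j) (w j₀) / (lam j₀ - lam j)) • w j) 0 := by
    refine HasDerivAt.fun_sum fun j _ => HasDerivAt.smul_const ?_ _
    -- For j = j₀ the stated coefficient is a division by zero, hence 0, in agreement with `hmain`.
    by_cases hj : j = j₀
    · subst hj
      simpa using hmain
    · exact hcoord j hj
  simpa only [w.sum_repr'] using hsum

end Perturbation

/-! ### Matrices as operators on Euclidean spaces -/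

section Matrices

open Matrix

theorem toEuclideanLin_mul {l m n : ℕ} (A : Matrix (Fin l) (Fin m) ℝ)
    (B : Matrix (Fin m) (Fin n) ℝ) (x : EuclideanSpace ℝ (Fin n)) :
    toEuclideanLin (A * B) x = toEuclideanLin A (toEuclideanLin B x) := by
  simp [toLpLin_apply, Matrix.mulVec_mulVec]

theorem inner_toEuclideanLin_left {m n : ℕ} (A : Matrix (Fin m) (Fin n) ℝ)
    (x : EuclideanSpace ℝ (Fin n)) (y : EuclideanSpace ℝ (Fin m)) :
    inner ℝ (toEuclideanLin A x) y = inner ℝ x (toEuclideanLin Aᵀ y) := by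
  rw [← conjTranspose_eq_transpose_of_trivial, toEuclideanLin_conjTranspose_eq_adjoint,
    LinearMap.adjoint_inner_right]

theorem inner_toEuclideanLin_right {m n : ℕ} (A : Matrix (Fin m) (Fin n) ℝ)
    (x : EuclideanSpace ℝ (Fin m)) (y : EuclideanSpace ℝ (Fin n)) :
    inner ℝ x (toEuclideanLin A y) = inner ℝ (toEuclideanLin Aᵀ x) y := by
  rw [inner_toEuclideanLin_left, transpose_transpose]

theorem isSymmetric_toEuclideanLin {m : ℕ} {A : Matrix (Fin m) (Fin m) ℝ} (hA : Aᵀ = A) :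
    (toEuclideanLin A).IsSymmetric := fun x y => by
  rw [inner_toEuclideanLin_left, hA]

/-- The linear isometry of Euclidean space given by an orthogonal matrix. -/
noncomputable def orthogonalIsometry {m : ℕ} {R : Matrix (Fin m) (Fin m) ℝ}
    (hR : R ∈ orthogonalGroup (Fin m) ℝ) :
    EuclideanSpace ℝ (Fin m) ≃ₗᵢ[ℝ] EuclideanSpace ℝ (Fin m) :=
  LinearIsometryEquiv.ofLinearIsometry
    ((toEuclideanLin R).isometryOfInner fun x y => by
      rw [inner_toEuclideanLin_left, ← toEuclideanLin_mul,
        show Rᵀ * R = 1 from (mem_orthogonalGroup_iff' (Fin m) ℝ).1 hR]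
      simp)
    (toEuclideanLin Rᵀ)
    (by
      ext1 x
      change toEuclideanLin R (toEuclideanLin Rᵀ x) = x
      rw [← toEuclideanLin_mul,
        show R * Rᵀ = 1 from (mem_orthogonalGroup_iff (Fin m) ℝ).1 hR]
      simp)
    (by
      ext1 x
      change toEuclideanLin Rᵀ (toEuclideanLin R x) = x
      rw [← toEuclideanLin_mul,
        show Rᵀ * R = 1 from (mem_orthogonalGroup_iff' (Fin m) ℝ).1 hR]
      simp)

theorem orthogonalIsometry_apply {m : ℕ} {R : Matrix (Fin m) (Fin m) ℝ}
    (hR : R ∈ orthogonalGroup (Fin m) ℝ) (x : EuclideanSpace ℝ (Fin m)) :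
    orthogonalIsometry hR x = toEuclideanLin R x := rfl

theorem transpose_toEuclideanLin_orthogonal {m : ℕ} {R : Matrix (Fin m) (Fin m) ℝ}
    (hR : R ∈ orthogonalGroup (Fin m) ℝ) (x : EuclideanSpace ℝ (Fin m)) :
    toEuclideanLin Rᵀ (toEuclideanLin R x) = x := by
  rw [← toEuclideanLin_mul, show Rᵀ * R = 1 from (mem_orthogonalGroup_iff' (Fin m) ℝ).1 hR]
  simp

end Matrices

/-! ### Singular value decompositions with distinct positive singular values -/

section SingularValueDecomposition

open Matrix InnerProductSpace

variable {d n k : ℕ} {α β : Type*} [Fintype α] [Fintype β]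

/-- A singular value decomposition of a matrix with pairwise distinct positive singular values
`ξ`: the orthonormal bases `u` and `v` consist of the singular vectors for the positive singular
values, followed by bases of the kernels. -/
structure IsSVD (Z : Matrix (Fin d) (Fin n) ℝ) (ξ : Fin k → ℝ)
    (u : OrthonormalBasis (Fin k ⊕ α) ℝ (EuclideanSpace ℝ (Fin d)))
    (v : OrthonormalBasis (Fin k ⊕ β) ℝ (EuclideanSpace ℝ (Fin n))) : Prop where
  pos : ∀ i, 0 < ξ i
  strictAnti : StrictAnti ξ
  apply_inl : ∀ i, toEuclideanLin Z (v (.inl i)) = ξ i • u (.inl i)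
  apply_inr : ∀ b, toEuclideanLin Z (v (.inr b)) = 0

variable {Z : Matrix (Fin d) (Fin n) ℝ} {ξ : Fin k → ℝ}
  {u : OrthonormalBasis (Fin k ⊕ α) ℝ (EuclideanSpace ℝ (Fin d))}
  {v : OrthonormalBasis (Fin k ⊕ β) ℝ (EuclideanSpace ℝ (Fin n))}

theorem IsSVD.transpose_inl (h : IsSVD Z ξ u v) (i : Fin k) :
    toEuclideanLin Zᵀ (u (.inl i)) = ξ i • v (.inl i) := by
  classical
  refine ext_inner_left_basis v.toBasis fun b => ?_
  rw [OrthonormalBasis.coe_toBasis, ← inner_toEuclideanLin_left, inner_smul_right]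
  rcases b with j | b
  · rw [h.apply_inl, inner_smul_left, u.inner_eq_ite, v.inner_eq_ite]
    by_cases hij : j = i <;> simp [hij]
  · simp [h.apply_inr, v.inner_eq_ite]

theorem IsSVD.transpose_inr (h : IsSVD Z ξ u v) (a : α) :
    toEuclideanLin Zᵀ (u (.inr a)) = 0 := by
  classical
  refine ext_inner_left_basis v.toBasis fun b => ?_
  rw [OrthonormalBasis.coe_toBasis, ← inner_toEuclideanLin_left]
  rcases b with j | b
  · simp [h.apply_inl, inner_smul_left, u.inner_eq_ite]
  · simp [h.apply_inr]

/-- This duality reduces statements about v, Zᵀ Z and inner tangents to those about u, Z Zᵀ and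
outer tangents. -/
theorem IsSVD.transpose (h : IsSVD Z ξ u v) : IsSVD Zᵀ ξ v u :=
  ⟨h.pos, h.strictAnti, h.transpose_inl, h.transpose_inr⟩

theorem IsSVD.sq_injective (h : IsSVD Z ξ u v) {i j : Fin k} (hij : ξ i ^ 2 = ξ j ^ 2) : i = j :=
  h.strictAnti.injective ((sq_eq_sq₀ (h.pos i).le (h.pos j).le).1 hij)

theorem IsSVD.gramL_apply (h : IsSVD Z ξ u v) (a : Fin k ⊕ α) :
    toEuclideanLin (gramL Z) (u a) = Sum.elim (fun i => ξ i ^ 2) (fun _ => 0) a • u a := by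
  rw [gramL, toEuclideanLin_mul]
  rcases a with i | a
  · simp [h.transpose_inl, h.apply_inl, smul_smul, sq]
  · simp [h.transpose_inr]

theorem IsSVD.gramR_apply (h : IsSVD Z ξ u v) (b : Fin k ⊕ β) :
    toEuclideanLin (gramR Z) (v b) = Sum.elim (fun i => ξ i ^ 2) (fun _ => 0) b • v b := by
  simpa [gramL, gramR] using h.transpose.gramL_apply b

/-- Coordinates along eigenvectors of other eigenvalues vanish, so a simple eigenvalue has a
one-dimensional eigenspace. This leaves only the sign of a unit eigenvector free. -/
theorem eigenvector_eq_smul {ι E : Type*} [Fintype ι] [NormedAddCommGroup E]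
    [InnerProductSpace ℝ E] {w : OrthonormalBasis ι ℝ E} {T : E →ₗ[ℝ] E} {lam : ι → ℝ}
    (hT : T.IsSymmetric) (hw : ∀ j, T (w j) = lam j • w j) {j₀ : ι}
    (hsimple : ∀ j, j ≠ j₀ → lam j ≠ lam j₀) {x : E} (hx : T x = lam j₀ • x) :
    x = inner ℝ (w j₀) x • w j₀ := by
  classical
  conv_lhs => rw [← w.sum_repr' x]
  refine Finset.sum_eq_single j₀ (fun j _ hj => ?_) (by simp)
  have := sub_mul_inner_eq_of_eigenvector hT hx (lam j) (w j)
  rw [hw, sub_self, inner_zero_left, mul_eq_zero, sub_eq_zero] at this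
  rw [this.resolve_left (hsimple j hj).symm, zero_smul]

theorem IsSVD.simple (h : IsSVD Z ξ u v) (γ : Type*) (i : Fin k) (b : Fin k ⊕ γ)
    (hb : b ≠ .inl i) : (Sum.elim (fun i => ξ i ^ 2) (fun _ => 0) b : ℝ) ≠
      Sum.elim (fun i => ξ i ^ 2) (fun _ => 0) (Sum.inl i : Fin k ⊕ γ) := by
  rcases b with j | b
  · intro heq
    exact hb (congrArg _ (h.sq_injective heq))
  · exact (pow_pos (h.pos i) 2).ne

theorem gramR_transpose (Z : Matrix (Fin d) (Fin n) ℝ) : (gramR Z)ᵀ = gramR Z := by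
  simp [gramR, transpose_mul]

theorem gramL_transpose (Z : Matrix (Fin d) (Fin n) ℝ) : (gramL Z)ᵀ = gramL Z := by
  simp [gramL, transpose_mul]

theorem adjoint_comp_self_eq_gramR (Z : Matrix (Fin d) (Fin n) ℝ) :
    (toEuclideanLin Z).adjoint ∘ₗ toEuclideanLin Z = toEuclideanLin (gramR Z) := by
  ext1 x
  rw [LinearMap.comp_apply, ← toEuclideanLin_conjTranspose_eq_adjoint,
    conjTranspose_eq_transpose_of_trivial, gramR, toEuclideanLin_mul]

/-- An orthonormal eigenbasis of `Zᵀ Z`, in the order of the singular values. -/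
theorem exists_orthonormalBasis_gramR (Z : Matrix (Fin d) (Fin n) ℝ) :
    ∃ b : OrthonormalBasis (Fin n) ℝ (EuclideanSpace ℝ (Fin n)), ∀ i : Fin n,
      toEuclideanLin (gramR Z) (b i) = sval Z i ^ 2 • b i := by
  have hn : Module.finrank ℝ (EuclideanSpace ℝ (Fin n)) = n := by simp
  refine ⟨(toEuclideanLin Z).isSymmetric_adjoint_comp_self.eigenvectorBasis hn, fun i => ?_⟩
  rw [← adjoint_comp_self_eq_gramR, sval, LinearMap.sq_singularValues_fin _ hn]
  exact LinearMap.IsSymmetric.apply_eigenvectorBasis _ hn i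

theorem sval_nonneg (Z : Matrix (Fin d) (Fin n) ℝ) (i : ℕ) : 0 ≤ sval Z i :=
  LinearMap.singularValues_nonneg _ i

theorem sval_antitone (Z : Matrix (Fin d) (Fin n) ℝ) : Antitone (sval Z) :=
  LinearMap.singularValues_antitone _

theorem sval_pos_iff (Z : Matrix (Fin d) (Fin n) ℝ) (i : ℕ) : 0 < sval Z i ↔ i < numPos Z := by
  rw [sval, numPos, LinearMap.card_support_singularValues,
    LinearMap.singularValues_pos_iff_lt_finrank_range]

theorem lt_of_sval_pos {i : ℕ} (h : 0 < sval Z i) : i < n := by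
  by_contra! hi
  rw [sval, LinearMap.singularValues_of_finrank_le _ (by simpa using hi)] at h
  exact h.false

/-- The right side mentions Z alone, so all decompositions of Z share one set of singular values. -/
theorem IsSVD.range_eq (h : IsSVD Z ξ u v) :
    Set.range ξ = {s | 0 < s ∧ ∃ x ≠ 0, toEuclideanLin (gramR Z) x = s ^ 2 • x} := by
  ext s
  constructor
  · rintro ⟨i, rfl⟩
    exact ⟨h.pos i, v (.inl i), v.toBasis.ne_zero (.inl i) ∘ by simp, h.gramR_apply (.inl i)⟩
  · rintro ⟨hs, x, hx0, hx⟩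
    by_contra hno
    refine hx0 ?_
    rw [← v.sum_repr' x]
    refine Finset.sum_eq_zero fun c _ => ?_
    have := sub_mul_inner_eq_of_eigenvector (isSymmetric_toEuclideanLin (gramR_transpose Z)) hx
      (Sum.elim (fun i => ξ i ^ 2) (fun _ => 0) c) (v c)
    rw [h.gramR_apply, sub_self, inner_zero_left, mul_eq_zero, sub_eq_zero] at this
    rw [this.resolve_left, zero_smul]
    rcases c with c | c
    · exact fun heq => hno ⟨c, ((sq_eq_sq₀ hs.le (h.pos c).le).1 heq).symm⟩
    · exact (pow_pos hs 2).ne'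

/-- A repeated positive singular value would give two orthogonal unit eigenvectors of Zᵀ Z in a
one-dimensional eigenspace. Membership of R Z Qᵀ and (Z 0) in the domain is proved by exhibiting a
decomposition. -/
theorem IsSVD.mem_distinctDomain (h : IsSVD Z ξ u v) : Z ∈ distinctDomain d n := by
  classical
  intro i j hi hij
  by_contra hne
  have hj : 0 < sval Z j := hij ▸ hi
  obtain ⟨b, hb⟩ := exists_orthonormalBasis_gramR Z
  have hbi := hb ⟨i, lt_of_sval_pos hi⟩
  have hbj := hb ⟨j, lt_of_sval_pos hj⟩
  set x := b ⟨i, lt_of_sval_pos hi⟩ with hx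
  set y := b ⟨j, lt_of_sval_pos hj⟩ with hy
  simp only at hbi hbj
  rw [← hij] at hbj
  have hsymm := isSymmetric_toEuclideanLin (gramR_transpose Z)
  have hxy : inner ℝ x y = 0 := b.inner_eq_zero (by simpa using hne)
  have hx1 : ‖x‖ = 1 := by simp [hx]
  have hy1 : ‖y‖ = 1 := by simp [hy]
  obtain ⟨a, ha⟩ : sval Z i ∈ Set.range ξ := by
    rw [h.range_eq]
    exact ⟨hi, x, by rintro h0; simp [h0] at hx1, hbi⟩
  have key : ∀ z : EuclideanSpace ℝ (Fin n), toEuclideanLin (gramR Z) z = sval Z i ^ 2 • z →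
      z = inner ℝ (v (.inl a)) z • v (.inl a) := fun z hz =>
    eigenvector_eq_smul hsymm h.gramR_apply (h.simple _ a) (by rw [hz, Sum.elim_inl, ha])
  have ex := key x hbi
  have ey := key y hbj
  rw [ex, ey, inner_smul_left, inner_smul_right] at hxy
  simp only [conj_trivial, real_inner_self_eq_norm_sq, OrthonormalBasis.norm_eq_one, one_pow,
    mul_one, mul_eq_zero] at hxy
  rcases hxy with h0 | h0
  · rw [h0, zero_smul] at ex
    simp [ex] at hx1
  · rw [h0, zero_smul] at ey
    simp [ey] at hy1

theorem sval_strictAnti (hZ : Z ∈ distinctDomain d n) :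
    StrictAnti fun i : Fin (numPos Z) => sval Z i := by
  intro i j hij
  refine lt_of_le_of_ne (sval_antitone Z hij.le) fun heq => ?_
  exact hij.ne' (Fin.ext (hZ j i ((sval_pos_iff Z j).2 j.2) heq))

theorem exists_isSVD (hZ : Z ∈ distinctDomain d n) :
    ∃ (u : OrthonormalBasis (Fin (numPos Z) ⊕ Fin (d - numPos Z)) ℝ (EuclideanSpace ℝ (Fin d)))
      (v : OrthonormalBasis (Fin (numPos Z) ⊕ Fin (n - numPos Z)) ℝ (EuclideanSpace ℝ (Fin n))),
      IsSVD Z (fun i : Fin (numPos Z) => sval Z i) u v := by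
  classical
  obtain ⟨b, hb⟩ := exists_orthonormalBasis_gramR Z
  have hkn : numPos Z ≤ n := by
    by_contra! hlt
    exact (lt_of_sval_pos ((sval_pos_iff Z n).2 hlt)).false
  have hkd : numPos Z ≤ d := by
    rw [numPos, LinearMap.card_support_singularValues]
    simpa using Submodule.finrank_le (LinearMap.range (toEuclideanLin Z))
  have hpos : ∀ i : Fin (numPos Z), 0 < sval Z i := fun i => (sval_pos_iff Z i).2 i.2
  let e : Fin n ≃ Fin (numPos Z) ⊕ Fin (n - numPos Z) :=
    (finCongr (by omega)).trans finSumFinEquiv.symm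
  have he : ∀ i, ((e.symm (.inl i) : Fin n) : ℕ) = i := fun i => by simp [e]
  have he' : ∀ i, numPos Z ≤ ((e.symm (.inr i) : Fin n) : ℕ) := fun i => by simp [e]
  let v := b.reindex e
  have hv : ∀ i, toEuclideanLin (gramR Z) (v (.inl i)) = sval Z i ^ 2 • v (.inl i) := fun i => by
    simp only [v, OrthonormalBasis.reindex_apply, hb, he]
  have hinner : ∀ x y, inner ℝ (toEuclideanLin Z x) (toEuclideanLin Z y) =
      inner ℝ x (toEuclideanLin (gramR Z) y) := fun x y => by
    rw [inner_toEuclideanLin_left, gramR, toEuclideanLin_mul]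
  -- The zeros are placeholders: only the restriction to the left summand, orthonormal because the
  -- v_i are eigenvectors of Zᵀ Z, is extended to a basis.
  let u₀ : Fin (numPos Z) ⊕ Fin (d - numPos Z) → EuclideanSpace ℝ (Fin d) :=
    Sum.elim (fun i => (sval Z i)⁻¹ • toEuclideanLin Z (v (.inl i))) (fun _ => 0)
  have hu₀ : Orthonormal ℝ ((Set.range Sum.inl).domRestrict u₀) := by
    rw [orthonormal_iff_ite]
    rintro ⟨_, i, rfl⟩ ⟨_, j, rfl⟩
    simp only [Set.domRestrict_apply, u₀, Sum.elim_inl, inner_smul_left, inner_smul_right, hinner,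
      hv, v.inner_eq_ite]
    have := (hpos i).ne'
    by_cases hij : i = j
    · subst hij
      simp
      field_simp
    · simp [hij, Subtype.ext_iff]
  obtain ⟨u, hu⟩ := hu₀.exists_orthonormalBasis_extension_of_card_eq
    (by simp [Nat.add_sub_cancel' hkd])
  refine ⟨u, v, hpos, sval_strictAnti hZ, fun i => ?_, fun i => ?_⟩
  · rw [hu _ ⟨i, rfl⟩]
    simp [u₀, smul_smul, (hpos i).ne']
  · have h0 : sval Z (e.symm (.inr i)) = 0 :=
      le_antisymm (not_lt.1 fun h => ((sval_pos_iff Z _).1 h).not_ge (he' i)) (sval_nonneg _ _)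
    rw [← inner_self_eq_zero (𝕜 := ℝ), hinner]
    simp [v, hb, h0]

theorem IsSVD.range_sval (h : IsSVD Z ξ u v) :
    (Set.range fun i : Fin (numPos Z) => sval Z i) = Set.range ξ := by
  obtain ⟨u', v', h'⟩ := exists_isSVD h.mem_distinctDomain
  rw [h.range_eq, h'.range_eq]

theorem IsSVD.numPos_eq (h : IsSVD Z ξ u v) : numPos Z = k := by
  have h1 := Set.ncard_range_of_injective (sval_strictAnti h.mem_distinctDomain).injective
  have h2 := Set.ncard_range_of_injective h.strictAnti.injective
  rw [h.range_sval, h2] at h1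
  simpa using h1.symm

end SingularValueDecomposition

open Matrix

/-! ### Dot derivatives of eigenvectors and the energies they define -/

section EigenFrame

variable {d n m : ℕ} {γ : Type*} {Z Z' : Matrix (Fin d) (Fin n) ℝ}
  {gram : Matrix (Fin d) (Fin n) ℝ → Matrix (Fin m) (Fin m) ℝ} {D : Matrix (Fin m) (Fin m) ℝ}

theorem sval_sq_pos (i : Fin (numPos Z)) : 0 < sval Z i ^ 2 :=
  pow_pos ((sval_pos_iff Z i).2 i.2) 2

theorem sval_sq_ne (hZ : Z ∈ distinctDomain d n) (i : Fin (numPos Z))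
    (b : Fin (numPos Z) ⊕ γ) (hb : b ≠ .inl i) :
    (Sum.elim (fun i : Fin (numPos Z) => sval Z i ^ 2) (fun _ => 0) b : ℝ) ≠
      Sum.elim (fun i : Fin (numPos Z) => sval Z i ^ 2) (fun _ => 0)
        (Sum.inl i : Fin (numPos Z) ⊕ γ) := by
  rcases b with j | b
  · intro heq
    refine hb (congrArg _ ((sval_strictAnti hZ).injective ?_))
    exact (sq_eq_sq₀ (sval_nonneg _ _) (sval_nonneg _ _)).1 heq
  · exact (sval_sq_pos i).ne

variable [Fintype γ] {w : OrthonormalBasis (Fin (numPos Z) ⊕ γ) ℝ (EuclideanSpace ℝ (Fin m))}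

/-- `D` is the derivative of the symmetric matrix function `gram` at `Z` in the direction `Z'`, and
`w` is an orthonormal eigenbasis of `gram Z` for the squared singular values and zero. -/
structure IsEigenFrame (gram : Matrix (Fin d) (Fin n) ℝ → Matrix (Fin m) (Fin m) ℝ)
    (Z Z' : Matrix (Fin d) (Fin n) ℝ) (D : Matrix (Fin m) (Fin m) ℝ)
    (w : OrthonormalBasis (Fin (numPos Z) ⊕ γ) ℝ (EuclideanSpace ℝ (Fin m))) : Prop where
  mem : Z ∈ distinctDomain d n
  symm : ∀ Y, (gram Y)ᵀ = gram Y
  hasDerivAt : ∀ c, IsMotion Z Z' c → ∀ x,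
    HasDerivAt (fun t => toEuclideanLin (gram (c t)) x) (toEuclideanLin D x) 0
  apply : ∀ a, toEuclideanLin (gram Z) (w a) =
    Sum.elim (fun i : Fin (numPos Z) => sval Z i ^ 2) (fun _ => 0) a • w a

/-- The derivative of the `i`-th eigenvector given by first order perturbation theory. -/
noncomputable def eigenDot (D : Matrix (Fin m) (Fin m) ℝ)
    (w : OrthonormalBasis (Fin (numPos Z) ⊕ γ) ℝ (EuclideanSpace ℝ (Fin m)))
    (i : Fin (numPos Z)) : EuclideanSpace ℝ (Fin m) :=
  ∑ a, (inner ℝ (toEuclideanLin D (w a)) (w (.inl i)) /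
    (sval Z i ^ 2 - Sum.elim (fun i : Fin (numPos Z) => sval Z i ^ 2) (fun _ => 0) a)) • w a

/-- For `a = .inl i` the quotient is 0 by division by zero, as it must be: the derivative of a unit
vector is orthogonal to it. -/
theorem inner_eigenDot (D : Matrix (Fin m) (Fin m) ℝ)
    (w : OrthonormalBasis (Fin (numPos Z) ⊕ γ) ℝ (EuclideanSpace ℝ (Fin m)))
    (i : Fin (numPos Z)) (a : Fin (numPos Z) ⊕ γ) :
    inner ℝ (w a) (eigenDot D w i) = inner ℝ (toEuclideanLin D (w a)) (w (.inl i)) /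
      (sval Z i ^ 2 - Sum.elim (fun i : Fin (numPos Z) => sval Z i ^ 2) (fun _ => 0) a) := by
  rw [eigenDot, w.orthonormal.inner_right_fintype]

theorem exists_isMotion (Z Z' : Matrix (Fin d) (Fin n) ℝ) : ∃ c, IsMotion Z Z' c := by
  refine ⟨fun t => Z + t • Z', by simp, fun i j => ?_⟩
  simpa using ((hasDerivAt_id (0 : ℝ)).mul_const (Z' i j)).const_add (Z i j)

theorem IsEigenFrame.isEigenvectorDot (h : IsEigenFrame gram Z Z' D w) (i : Fin (numPos Z)) :
    IsEigenvectorDot gram Z Z' (w (.inl i)) (eigenDot D w i) := by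
  classical
  intro c hc
  have hsymm : ∀ t, (toEuclideanLin (gram (c t))).IsSymmetric := fun t =>
    isSymmetric_toEuclideanLin (h.symm _)
  have h0 : ∀ a, toEuclideanLin (gram (c 0)) (w a) =
      Sum.elim (fun i : Fin (numPos Z) => sval Z i ^ 2) (fun _ => 0) a • w a := by
    rw [hc.1]
    exact h.apply
  have hG := fun a => h.hasDerivAt c hc (w a)
  refine ⟨?_, fun x hx => ?_⟩
  · obtain ⟨x, hx0, hxc, hx⟩ := exists_eigenvector_continuousAt hsymm h0
      (fun a => (hG a).continuousAt) (sval_sq_ne h.mem i)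
    exact ⟨x, hx0, hxc, Filter.Eventually.of_forall hx⟩
  · exact hasDerivAt_eigenvector hsymm h0 hG (sval_sq_ne h.mem i) hx.1 hx.2.1 hx.2.2

theorem IsEigenFrame.isEigenSystem (h : IsEigenFrame gram Z Z' D w) :
    IsEigenSystem gram Z Z' (fun i => w (.inl i), eigenDot D w) := fun i =>
  ⟨by simp, h.apply (.inl i), h.isEigenvectorDot i⟩

theorem IsEigenBranch.neg {G : ℝ → Matrix (Fin m) (Fin m) ℝ} {u : EuclideanSpace ℝ (Fin m)}
    {x : ℝ → EuclideanSpace ℝ (Fin m)} (hx : IsEigenBranch G u x) :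
    IsEigenBranch G (-u) (-x) := by
  refine ⟨by simp [hx.1], hx.2.1.neg, ?_⟩
  filter_upwards [hx.2.2] with t ⟨ht, μ, hμ⟩
  exact ⟨by simpa using ht, μ, by simp [hμ]⟩

theorem IsEigenvectorDot.neg {u y : EuclideanSpace ℝ (Fin m)}
    (h : IsEigenvectorDot gram Z Z' u y) : IsEigenvectorDot gram Z Z' (-u) (-y) := by
  intro c hc
  obtain ⟨⟨x, hx⟩, hall⟩ := h c hc
  refine ⟨⟨-x, hx.neg⟩, fun x' hx' => ?_⟩
  have := (hall (-x') (by simpa using hx'.neg)).neg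
  simpa using this

theorem IsEigenvectorDot.unique {u y y' : EuclideanSpace ℝ (Fin m)}
    (h : IsEigenvectorDot gram Z Z' u y) (h' : IsEigenvectorDot gram Z Z' u y') : y = y' := by
  obtain ⟨c, hc⟩ := exists_isMotion Z Z'
  obtain ⟨⟨x, hx⟩, hall⟩ := h c hc
  exact (hall x hx).unique ((h' c hc).2 x hx)

/-- Eigenvectors and their derivatives are determined up to a common sign. -/
theorem IsEigenFrame.exists_sign (h : IsEigenFrame gram Z Z' D w) {p}
    (hp : IsEigenSystem gram Z Z' p) (i : Fin (numPos Z)) :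
    ∃ s : ℝ, s ^ 2 = 1 ∧ p.1 i = s • w (.inl i) ∧ p.2 i = s • eigenDot D w i := by
  obtain ⟨h1, h2, h3⟩ := hp i
  have he : p.1 i = inner ℝ (w (.inl i)) (p.1 i) • w (.inl i) :=
    eigenvector_eq_smul (isSymmetric_toEuclideanLin (h.symm Z)) h.apply (sval_sq_ne h.mem i) h2
  set s : ℝ := inner ℝ (w (.inl i)) (p.1 i)
  have hs : s ^ 2 = 1 := by
    rw [he, norm_smul, w.norm_eq_one, mul_one, Real.norm_eq_abs] at h1
    rw [← sq_abs, h1, one_pow]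
  refine ⟨s, hs, he, ?_⟩
  rw [he] at h3
  rcases sq_eq_one_iff.1 hs with hs | hs
  · rw [hs, one_smul] at h3 ⊢
    exact h3.unique (h.isEigenvectorDot i)
  · rw [hs, neg_one_smul] at h3 ⊢
    exact h3.unique (h.isEigenvectorDot i).neg

/-- The kernel is spanned by the right-hand basis vectors, because the remaining eigenvalues are
positive. -/
theorem norm_sq_starProjection_ker (h : IsEigenFrame gram Z Z' D w)
    (x : EuclideanSpace ℝ (Fin m)) :
    ‖(LinearMap.ker (toEuclideanLin (gram Z))).starProjection x‖ ^ 2 =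
      ∑ c : γ, (inner ℝ (w (.inr c)) x) ^ 2 := by
  classical
  have hP : (LinearMap.ker (toEuclideanLin (gram Z))).starProjection x =
      ∑ c : γ, inner ℝ (w (.inr c)) x • w (.inr c) := by
    refine Submodule.eq_starProjection_of_mem_of_inner_eq_zero ?_ fun y hy => ?_
    · refine Submodule.sum_mem _ fun c _ => Submodule.smul_mem _ _ ?_
      rw [LinearMap.mem_ker, h.apply]
      simp
    · set P := ∑ c : γ, inner ℝ (w (.inr c)) x • w (.inr c) with hP
      have hyi : ∀ i, inner ℝ (w (.inl i)) y = 0 := fun i => by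
        have := sub_mul_inner_eq_of_eigenvector (isSymmetric_toEuclideanLin (h.symm Z))
          (x := y) (μ := 0) (by rw [LinearMap.mem_ker.1 hy, zero_smul]) (sval Z i ^ 2) (w (.inl i))
        rw [h.apply, Sum.elim_inl, sub_self, inner_zero_left, zero_sub, mul_eq_zero,
          neg_eq_zero] at this
        exact this.resolve_left (sval_sq_pos i).ne'
      conv_lhs => rw [← w.sum_repr' x]
      rw [Fintype.sum_sum_type, ← hP, add_sub_cancel_right, sum_inner]
      exact Finset.sum_eq_zero fun i _ => by rw [inner_smul_left, hyi, mul_zero]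
  rw [hP, ← w.sum_sq_inner_right, Fintype.sum_sum_type]
  simp [inner_sum, inner_smul_right, w.inner_eq_ite]

/-- The signs enter only through their squares, so the value is the same for every p; this gives
both well-definedness and the evaluation at the chosen system. -/
theorem IsEigenFrame.energyA_eq (h : IsEigenFrame gram Z Z' D w) {p}
    (hp : IsEigenSystem gram Z Z' p) (M : ℝ) :
    energyA M (fun i : Fin (numPos Z) => sval Z i) p = M / 2 * ∑ i : Fin (numPos Z), sval Z i ^ 2 *
      ∑ j : Fin (numPos Z), (inner ℝ (toEuclideanLin D (w (.inl j))) (w (.inl i)) /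
        (sval Z i ^ 2 - sval Z j ^ 2)) ^ 2 := by
  choose s hs hp1 hp2 using h.exists_sign hp
  simp only [energyA, hp1, hp2, inner_smul_left, inner_smul_right, inner_eigenDot, Sum.elim_inl,
    conj_trivial, mul_pow, hs, one_mul]

theorem IsEigenFrame.energyB_eq (h : IsEigenFrame gram Z Z' D w) {p}
    (hp : IsEigenSystem gram Z Z' p) (M : ℝ) :
    energyB M (fun i : Fin (numPos Z) => sval Z i) (gram Z) p =
      M / 2 * ∑ i : Fin (numPos Z), sval Z i ^ 2 *
        ∑ c : γ, (inner ℝ (toEuclideanLin D (w (.inr c))) (w (.inl i)) / sval Z i ^ 2) ^ 2 := by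
  choose s hs hp1 hp2 using h.exists_sign hp
  simp only [energyB, norm_sq_starProjection_ker h, hp2, inner_smul_right, inner_eigenDot,
    Sum.elim_inr, sub_zero, mul_pow, hs, one_mul]

theorem IsEigenFrame.eigenSystem_spec (h : IsEigenFrame gram Z Z' D w) :
    IsEigenSystem gram Z Z' (eigenSystem gram Z Z') :=
  Classical.epsilon_spec ⟨_, h.isEigenSystem⟩

end EigenFrame

/-! ### Derivatives of Z Zᵀ and Zᵀ Z along a motion -/

section Gram

variable {d n : ℕ} {Z Z' : Matrix (Fin d) (Fin n) ℝ}

theorem IsMotion.transpose {c : ℝ → Matrix (Fin d) (Fin n) ℝ} (hc : IsMotion Z Z' c) :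
    IsMotion Zᵀ Z'ᵀ fun t => (c t)ᵀ :=
  ⟨by simp [hc.1], fun i j => hc.2 j i⟩

theorem hasDerivAt_euclidean {m : ℕ} {f : ℝ → EuclideanSpace ℝ (Fin m)}
    {f' : EuclideanSpace ℝ (Fin m)} {t : ℝ} (h : ∀ i, HasDerivAt (fun t => f t i) (f' i) t) :
    HasDerivAt f f' t := by
  have := (PiLp.continuousLinearEquiv 2 ℝ fun _ : Fin m => ℝ).symm.hasFDerivAt.comp_hasDerivAt t
    (hasDerivAt_pi.2 h)
  exact this

theorem hasDerivAt_gramL {c : ℝ → Matrix (Fin d) (Fin n) ℝ} (hc : IsMotion Z Z' c)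
    (x : EuclideanSpace ℝ (Fin d)) :
    HasDerivAt (fun t => toEuclideanLin (gramL (c t)) x)
      (toEuclideanLin (Z' * Zᵀ + Z * Z'ᵀ) x) 0 := by
  refine hasDerivAt_euclidean fun i => ?_
  simp only [toLpLin_apply, mulVec, dotProduct, gramL, Matrix.mul_apply, Matrix.add_apply,
    transpose_apply, ← Finset.sum_add_distrib]
  refine HasDerivAt.fun_sum fun j _ => HasDerivAt.mul_const ?_ _
  refine HasDerivAt.fun_sum fun l _ => ?_
  have := (hc.2 i l).fun_mul (hc.2 j l)
  rwa [hc.1] at this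

theorem hasDerivAt_gramR {c : ℝ → Matrix (Fin d) (Fin n) ℝ} (hc : IsMotion Z Z' c)
    (x : EuclideanSpace ℝ (Fin n)) :
    HasDerivAt (fun t => toEuclideanLin (gramR (c t)) x)
      (toEuclideanLin (Z'ᵀ * Z + Zᵀ * Z') x) 0 := by
  simpa [gramL, gramR] using hasDerivAt_gramL hc.transpose x

end Gram

/-! ### The four energies in singular coordinates -/

section Energies

variable {d n k : ℕ} {α β : Type*} [Fintype α] [Fintype β]
  {Z : Matrix (Fin d) (Fin n) ℝ} {ξ : Fin k → ℝ}
  {u : OrthonormalBasis (Fin k ⊕ α) ℝ (EuclideanSpace ℝ (Fin d))}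
  {v : OrthonormalBasis (Fin k ⊕ β) ℝ (EuclideanSpace ℝ (Fin n))}

/-- A strictly decreasing enumeration is determined by its range. Hence formulas in `sval` hold for
any decomposition, whatever index types label its kernels. -/
theorem IsSVD.eq_sval {ξ : Fin (numPos Z) → ℝ}
    {u : OrthonormalBasis (Fin (numPos Z) ⊕ α) ℝ (EuclideanSpace ℝ (Fin d))}
    {v : OrthonormalBasis (Fin (numPos Z) ⊕ β) ℝ (EuclideanSpace ℝ (Fin n))}
    (h : IsSVD Z ξ u v) : ξ = fun i : Fin (numPos Z) => sval Z i :=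
  (h.strictAnti.range_inj (sval_strictAnti h.mem_distinctDomain)).1 h.range_sval.symm

section

variable {u : OrthonormalBasis (Fin (numPos Z) ⊕ α) ℝ (EuclideanSpace ℝ (Fin d))}
  {v : OrthonormalBasis (Fin (numPos Z) ⊕ β) ℝ (EuclideanSpace ℝ (Fin n))}

theorem IsSVD.isEigenFrame_gramL (h : IsSVD Z (fun i : Fin (numPos Z) => sval Z i) u v)
    (Z' : Matrix (Fin d) (Fin n) ℝ) :
    IsEigenFrame gramL Z Z' (Z' * Zᵀ + Z * Z'ᵀ) u :=
  ⟨h.mem_distinctDomain, gramL_transpose, fun _ hc => hasDerivAt_gramL hc, h.gramL_apply⟩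

theorem IsSVD.isEigenFrame_gramR (h : IsSVD Z (fun i : Fin (numPos Z) => sval Z i) u v)
    (Z' : Matrix (Fin d) (Fin n) ℝ) :
    IsEigenFrame gramR Z Z' (Z'ᵀ * Z + Zᵀ * Z') v :=
  ⟨h.mem_distinctDomain, gramR_transpose, fun _ hc => hasDerivAt_gramR hc, h.gramR_apply⟩

end

theorem energiesWellDefined (M : ℝ) (hZ : Z ∈ distinctDomain d n) (Z' : Matrix (Fin d) (Fin n) ℝ)
    (hdec : ∃! P, IsSingularDecomposition Z Z' P) : EnergiesWellDefined M Z Z' := by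
  obtain ⟨u, v, h⟩ := exists_isSVD hZ
  have hL := h.isEigenFrame_gramL Z'
  have hR := h.isEigenFrame_gramR Z'
  refine ⟨⟨_, hL.isEigenSystem⟩, fun p hp => ⟨?_, ?_⟩, ⟨_, hR.isEigenSystem⟩,
    fun p hp => ⟨?_, ?_⟩, hdec⟩
  · rw [EoutA, hL.energyA_eq hp, hL.energyA_eq hL.eigenSystem_spec]
  · rw [EoutB, hL.energyB_eq hp, hL.energyB_eq hL.eigenSystem_spec]
  · rw [EinA, hR.energyA_eq hp, hR.energyA_eq hR.eigenSystem_spec]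
  · rw [EinB, hR.energyB_eq hp, hR.energyB_eq hR.eigenSystem_spec]

/-- The entries of the matrix `A` with respect to two orthonormal bases. -/
noncomputable def coord {ι κ : Type*} [Fintype ι] [Fintype κ]
    (u : OrthonormalBasis ι ℝ (EuclideanSpace ℝ (Fin d)))
    (v : OrthonormalBasis κ ℝ (EuclideanSpace ℝ (Fin n))) (A : Matrix (Fin d) (Fin n) ℝ)
    (a : ι) (b : κ) : ℝ :=
  inner ℝ (u a) (toEuclideanLin A (v b))

theorem IsSVD.inner_dot_gramL (h : IsSVD Z ξ u v) (Z' : Matrix (Fin d) (Fin n) ℝ)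
    (i j : Fin k) :
    inner ℝ (toEuclideanLin (Z' * Zᵀ + Z * Z'ᵀ) (u (.inl j))) (u (.inl i)) =
      ξ j * coord u v Z' (.inl i) (.inl j) + ξ i * coord u v Z' (.inl j) (.inl i) := by
  rw [map_add, LinearMap.add_apply, toEuclideanLin_mul, toEuclideanLin_mul, inner_add_left,
    inner_toEuclideanLin_left Z, h.transpose_inl, h.transpose_inl, map_smul, inner_smul_left,
    inner_smul_right, ← inner_toEuclideanLin_right Z', coord, coord,
    real_inner_comm (u (.inl i))]
  simp

theorem IsSVD.inner_dot_gramL_inr (h : IsSVD Z ξ u v) (Z' : Matrix (Fin d) (Fin n) ℝ)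
    (i : Fin k) (a : α) :
    inner ℝ (toEuclideanLin (Z' * Zᵀ + Z * Z'ᵀ) (u (.inr a))) (u (.inl i)) =
      ξ i * coord u v Z' (.inr a) (.inl i) := by
  rw [map_add, LinearMap.add_apply, toEuclideanLin_mul, toEuclideanLin_mul, inner_add_left,
    inner_toEuclideanLin_left Z, h.transpose_inl, h.transpose_inr,
    inner_smul_right, ← inner_toEuclideanLin_right Z', coord]
  simp

theorem coord_transpose {ι κ : Type*} [Fintype ι] [Fintype κ]
    (u : OrthonormalBasis ι ℝ (EuclideanSpace ℝ (Fin d)))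
    (v : OrthonormalBasis κ ℝ (EuclideanSpace ℝ (Fin n))) (A : Matrix (Fin d) (Fin n) ℝ)
    (a : ι) (b : κ) : coord v u Aᵀ b a = coord u v A a b := by
  rw [coord, coord, ← inner_toEuclideanLin_left, real_inner_comm]

theorem IsSVD.EoutA_eq (h : IsSVD Z ξ u v) (M : ℝ) (Z' : Matrix (Fin d) (Fin n) ℝ) :
    EoutA M Z Z' = M / 2 * ∑ i, ξ i ^ 2 * ∑ j, ((ξ j * coord u v Z' (.inl i) (.inl j) +
      ξ i * coord u v Z' (.inl j) (.inl i)) / (ξ i ^ 2 - ξ j ^ 2)) ^ 2 := by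
  obtain rfl := h.numPos_eq
  obtain rfl := h.eq_sval
  have hL := h.isEigenFrame_gramL Z'
  simp only [EoutA, hL.energyA_eq hL.eigenSystem_spec, h.inner_dot_gramL]

/-- The kernel component of u̇_i is x_ai / ξ_i, and the weight ξ_i² cancels the denominator. -/
theorem IsSVD.EoutB_eq (h : IsSVD Z ξ u v) (M : ℝ) (Z' : Matrix (Fin d) (Fin n) ℝ) :
    EoutB M Z Z' = M / 2 * ∑ i, ∑ a, coord u v Z' (.inr a) (.inl i) ^ 2 := by
  obtain rfl := h.numPos_eq
  obtain rfl := h.eq_sval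
  have hL := h.isEigenFrame_gramL Z'
  simp only [EoutB, hL.energyB_eq hL.eigenSystem_spec, h.inner_dot_gramL_inr, Finset.mul_sum]
  congr! 4 with i _ a
  have := (h.pos i).ne'
  field_simp

theorem IsSVD.EinA_eq (h : IsSVD Z ξ u v) (M : ℝ) (Z' : Matrix (Fin d) (Fin n) ℝ) :
    EinA M Z Z' = M / 2 * ∑ i, ξ i ^ 2 * ∑ j, ((ξ j * coord u v Z' (.inl j) (.inl i) +
      ξ i * coord u v Z' (.inl i) (.inl j)) / (ξ i ^ 2 - ξ j ^ 2)) ^ 2 := by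
  obtain rfl := h.numPos_eq
  obtain rfl := h.eq_sval
  have hR := h.isEigenFrame_gramR Z'
  have := h.transpose.inner_dot_gramL Z'ᵀ
  simp only [transpose_transpose, coord_transpose] at this
  simp only [EinA, hR.energyA_eq hR.eigenSystem_spec, this]

theorem IsSVD.EinB_eq (h : IsSVD Z ξ u v) (M : ℝ) (Z' : Matrix (Fin d) (Fin n) ℝ) :
    EinB M Z Z' = M / 2 * ∑ i, ∑ b, coord u v Z' (.inl i) (.inr b) ^ 2 := by
  obtain rfl := h.numPos_eq
  obtain rfl := h.eq_sval
  have hR := h.isEigenFrame_gramR Z'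
  have := h.transpose.inner_dot_gramL_inr Z'ᵀ
  simp only [transpose_transpose, coord_transpose] at this
  simp only [EinB, hR.energyB_eq hR.eigenSystem_spec, this, Finset.mul_sum]
  congr! 4 with i _ a
  have := (h.pos i).ne'
  field_simp

end Energies

/-! ### The Frobenius inner product in arbitrary orthonormal bases -/

section Coordinates

variable {d n : ℕ} {ι κ : Type*} [Fintype ι] [Fintype κ]
  (u : OrthonormalBasis ι ℝ (EuclideanSpace ℝ (Fin d)))
  (v : OrthonormalBasis κ ℝ (EuclideanSpace ℝ (Fin n)))

theorem coord_add (A B : Matrix (Fin d) (Fin n) ℝ) (a : ι) (b : κ) :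
    coord u v (A + B) a b = coord u v A a b + coord u v B a b := by
  simp [coord, inner_add_right]

theorem coord_neg (A : Matrix (Fin d) (Fin n) ℝ) (a : ι) (b : κ) :
    coord u v (-A) a b = -coord u v A a b := by
  simp [coord]

theorem coord_sub (A B : Matrix (Fin d) (Fin n) ℝ) (a : ι) (b : κ) :
    coord u v (A - B) a b = coord u v A a b - coord u v B a b := by
  simp [coord, inner_sub_right]

/-- The trace does not involve v, so the orthonormal basis on the left may be exchanged for any
other. -/
theorem sum_inner_toEuclideanLin (A B : Matrix (Fin d) (Fin n) ℝ) :
    ∑ b, inner ℝ (toEuclideanLin A (v b)) (toEuclideanLin B (v b)) =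
      LinearMap.trace ℝ _ (toEuclideanLin (Aᵀ * B)) := by
  rw [LinearMap.trace_eq_sum_inner _ v]
  exact Finset.sum_congr rfl fun b _ => by rw [inner_toEuclideanLin_left, toEuclideanLin_mul]

theorem frob_apply (A : Matrix (Fin d) (Fin n) ℝ) (p : Fin d × Fin n) :
    frob A p = A p.1 p.2 := rfl

theorem inner_frob (A B : Matrix (Fin d) (Fin n) ℝ) :
    inner ℝ (frob A) (frob B) = ∑ a, ∑ b, coord u v A a b * coord u v B a b := by
  classical
  have h1 : inner ℝ (frob A) (frob B) = ∑ j, inner ℝ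
      (toEuclideanLin A (EuclideanSpace.basisFun (Fin n) ℝ j))
      (toEuclideanLin B (EuclideanSpace.basisFun (Fin n) ℝ j)) := by
    simp [frob_apply, PiLp.inner_apply, Fintype.sum_prod_type_right]
  rw [h1, sum_inner_toEuclideanLin, ← sum_inner_toEuclideanLin v, Finset.sum_comm]
  refine Finset.sum_congr rfl fun b _ => ?_
  rw [← u.sum_inner_mul_inner]
  exact Finset.sum_congr rfl fun a _ => by rw [coord, coord, real_inner_comm]

theorem norm_frob_sq (A : Matrix (Fin d) (Fin n) ℝ) :
    ‖frob A‖ ^ 2 = ∑ a, ∑ b, coord u v A a b ^ 2 := by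
  rw [← real_inner_self_eq_norm_sq, inner_frob u v]
  simp only [sq]

variable {u v} in
theorem coord_ext {A B : Matrix (Fin d) (Fin n) ℝ} (h : ∀ a b, coord u v A a b = coord u v B a b) :
    A = B := by
  rw [← sub_eq_zero, ← (frob (d := d) (n := n)).map_eq_zero_iff, ← norm_eq_zero,
    ← sq_eq_zero_iff, norm_frob_sq u v]
  simp [coord_sub, h]

theorem exists_coord_eq (s : ι → κ → ℝ) :
    ∃ A : Matrix (Fin d) (Fin n) ℝ, ∀ a b, coord u v A a b = s a b := by
  refine ⟨toEuclideanLin.symm (v.toBasis.constr ℝ fun b => ∑ a, s a b • u a), fun a b => ?_⟩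
  have : v.toBasis.constr ℝ (fun b => ∑ a, s a b • u a) (v b) = ∑ a, s a b • u a := by
    rw [← v.coe_toBasis, Module.Basis.constr_basis]
  rw [coord, LinearEquiv.apply_symm_apply, this, u.orthonormal.inner_right_fintype]

end Coordinates

/-! ### Outer and inner tangent spaces and the rotational component -/

section Tangent

variable {d n k : ℕ} {α β : Type*} [Fintype α] [Fintype β]
  {Z : Matrix (Fin d) (Fin n) ℝ} {ξ : Fin k → ℝ}
  {u : OrthonormalBasis (Fin k ⊕ α) ℝ (EuclideanSpace ℝ (Fin d))}
  {v : OrthonormalBasis (Fin k ⊕ β) ℝ (EuclideanSpace ℝ (Fin n))}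

theorem IsSVD.coord_mul_inl (h : IsSVD Z ξ u v) (S : Matrix (Fin d) (Fin d) ℝ)
    (a : Fin k ⊕ α) (j : Fin k) :
    coord u v (S * Z) a (.inl j) = ξ j * coord u u S a (.inl j) := by
  rw [coord, toEuclideanLin_mul, h.apply_inl, map_smul, inner_smul_right, coord]

theorem IsSVD.coord_mul_inr (h : IsSVD Z ξ u v) (S : Matrix (Fin d) (Fin d) ℝ)
    (a : Fin k ⊕ α) (b : β) : coord u v (S * Z) a (.inr b) = 0 := by
  rw [coord, toEuclideanLin_mul, h.apply_inr, map_zero, inner_zero_right]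

/-- Skewness can be read off in the basis u, and right multiplication by Z scales the j-th column by
ξ_j and kills the kernel columns. -/
theorem IsSVD.mem_outerTangent_iff (h : IsSVD Z ξ u v) {A : Matrix (Fin d) (Fin n) ℝ} :
    A ∈ outerTangent Z ↔ ∃ s : Fin k ⊕ α → Fin k ⊕ α → ℝ, (∀ a b, s a b = -s b a) ∧
      ∀ a, (∀ j, coord u v A a (.inl j) = ξ j * s a (.inl j)) ∧
        ∀ b, coord u v A a (.inr b) = 0 := by
  constructor
  · rintro ⟨S, hS, rfl⟩
    rw [LieAlgebra.Orthogonal.mem_so] at hS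
    refine ⟨coord u u S, fun a b => ?_, fun a => ⟨h.coord_mul_inl S a, h.coord_mul_inr S a⟩⟩
    rw [← coord_transpose, hS, coord_neg]
  · rintro ⟨s, hs, hA⟩
    obtain ⟨S, hS⟩ := exists_coord_eq u u s
    refine ⟨S, ?_, coord_ext (u := u) (v := v) fun a b => ?_⟩
    · rw [LieAlgebra.Orthogonal.mem_so]
      refine coord_ext (u := u) (v := u) fun a b => ?_
      rw [coord_transpose, coord_neg, hS, hS, hs]
    · rcases b with j | b
      · rw [(hA a).1, h.coord_mul_inl, hS]
      · rw [(hA a).2, h.coord_mul_inr]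

theorem mem_innerTangent_iff_transpose {A : Matrix (Fin d) (Fin n) ℝ} :
    A ∈ innerTangent Z ↔ Aᵀ ∈ outerTangent Zᵀ := by
  constructor
  · rintro ⟨S, hS, rfl⟩
    refine ⟨-S, neg_mem hS, ?_⟩
    rw [LieAlgebra.Orthogonal.mem_so] at hS
    rw [transpose_mul, hS]
  · rintro ⟨S, hS, hA⟩
    refine ⟨-S, neg_mem hS, ?_⟩
    rw [LieAlgebra.Orthogonal.mem_so] at hS
    rw [← transpose_transpose A, hA, transpose_mul, hS, transpose_transpose]

theorem IsSVD.mem_innerTangent_iff (h : IsSVD Z ξ u v) {A : Matrix (Fin d) (Fin n) ℝ} :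
    A ∈ innerTangent Z ↔ ∃ s : Fin k ⊕ β → Fin k ⊕ β → ℝ, (∀ a b, s a b = -s b a) ∧
      ∀ b, (∀ i, coord u v A (.inl i) b = ξ i * s b (.inl i)) ∧
        ∀ a, coord u v A (.inr a) b = 0 := by
  simp only [mem_innerTangent_iff_transpose, h.transpose.mem_outerTangent_iff, coord_transpose]

/-- Kernel columns vanish for outer tangents, kernel rows for inner ones, and the diagonal by
skewness. For i ≠ j the two descriptions of the entries (i,j) and (j,i) form a homogeneous system
whose determinant is nonzero because ξ_i ≠ ξ_j. -/
theorem IsSVD.disjoint_tangent (h : IsSVD Z ξ u v) :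
    Disjoint (outerTangent Z) (innerTangent Z) := by
  rw [Submodule.disjoint_def]
  intro A hout hin
  obtain ⟨s, hs, hA⟩ := h.mem_outerTangent_iff.1 hout
  obtain ⟨s', hs', hA'⟩ := h.mem_innerTangent_iff.1 hin
  refine coord_ext (u := u) (v := v) fun a b => ?_
  have h0 : coord u v (0 : Matrix (Fin d) (Fin n) ℝ) a b = 0 := by simp [coord]
  rw [h0]
  rcases a with i | a
  · rcases b with j | b
    · have e1 := (hA (.inl i)).1 j
      have e2 := (hA' (.inl j)).1 i
      have e3 := (hA (.inl j)).1 i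
      have e4 := (hA' (.inl i)).1 j
      rw [hs] at e3
      rw [hs'] at e4
      by_cases hij : i = j
      · subst hij
        have := hs (.inl i) (.inl i)
        rw [e1, show s (.inl i) (.inl i) = 0 by linarith, mul_zero]
      · have hne : ξ j ^ 2 - ξ i ^ 2 ≠ 0 := sub_ne_zero.2 fun heq => hij (h.sq_injective heq).symm
        have : (ξ j ^ 2 - ξ i ^ 2) * s (.inl i) (.inl j) = 0 := by
          linear_combination ξ j * e2 - ξ j * e1 - ξ i * e3 + ξ i * e4
        rw [e1, (mul_eq_zero.1 this).resolve_left hne, mul_zero]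
    · exact (hA _).2 b
  · exact (hA' _).2 a

/-- The entries of the outer part of the rotational component of a matrix with the entries `x` with
respect to the singular vectors. -/
noncomputable def outCoord (ξ : Fin k → ℝ) (x : Fin k ⊕ α → Fin k ⊕ β → ℝ) :
    Fin k ⊕ α → Fin k ⊕ β → ℝ
  | .inl i, .inl j => ξ j *
      ((ξ j * x (.inl i) (.inl j) + ξ i * x (.inl j) (.inl i)) / (ξ j ^ 2 - ξ i ^ 2))
  | .inr a, .inl j => x (.inr a) (.inl j)
  | _, .inr _ => 0

/-- The entries of the inner part of the rotational component of a matrix with the entries `x` with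
respect to the singular vectors. -/
noncomputable def inCoord (ξ : Fin k → ℝ) (x : Fin k ⊕ α → Fin k ⊕ β → ℝ) :
    Fin k ⊕ α → Fin k ⊕ β → ℝ
  | .inl i, .inl j => ξ i *
      ((ξ j * x (.inl j) (.inl i) + ξ i * x (.inl i) (.inl j)) / (ξ i ^ 2 - ξ j ^ 2))
  | .inl i, .inr b => x (.inl i) (.inr b)
  | .inr _, _ => 0

theorem IsSVD.mem_outerTangent (h : IsSVD Z ξ u v) {A : Matrix (Fin d) (Fin n) ℝ}
    {x : Fin k ⊕ α → Fin k ⊕ β → ℝ} (hA : ∀ a b, coord u v A a b = outCoord ξ x a b) :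
    A ∈ outerTangent Z := by
  -- The witness is s_aj = u_a · u̇_j, completed by skewness; the kernel-kernel block is free and
  -- set to 0.
  refine h.mem_outerTangent_iff.2 ⟨fun
    | .inl i, .inl j =>
      (ξ j * x (.inl i) (.inl j) + ξ i * x (.inl j) (.inl i)) / (ξ j ^ 2 - ξ i ^ 2)
    | .inr a, .inl j => x (.inr a) (.inl j) / ξ j
    | .inl j, .inr a => -(x (.inr a) (.inl j) / ξ j)
    | .inr _, .inr _ => 0, ?_, fun a => ⟨fun j => ?_, fun b => ?_⟩⟩
  · rintro (i | a) (j | b)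
    · simp only
      rw [← div_neg, neg_sub, add_comm]
    all_goals simp
  · rw [hA]
    rcases a with i | a
    · rfl
    · simp only [outCoord]
      rw [mul_div_cancel₀ _ (h.pos j).ne']
  · rw [hA]
    rcases a with i | a <;> rfl

theorem IsSVD.mem_innerTangent (h : IsSVD Z ξ u v) {A : Matrix (Fin d) (Fin n) ℝ}
    {x : Fin k ⊕ α → Fin k ⊕ β → ℝ} (hA : ∀ a b, coord u v A a b = inCoord ξ x a b) :
    A ∈ innerTangent Z := by
  refine mem_innerTangent_iff_transpose.2
    (h.transpose.mem_outerTangent (x := fun b a => x a b) fun b a => ?_)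
  rw [coord_transpose, hA]
  rcases a with i | a <;> rcases b with j | b <;> simp [inCoord, outCoord, add_comm]

theorem IsSVD.outCoord_add_inCoord (h : IsSVD Z ξ u v) (x : Fin k ⊕ α → Fin k ⊕ β → ℝ)
    {i j : Fin k} (hij : i ≠ j) :
    outCoord ξ x (.inl i) (.inl j) + inCoord ξ x (.inl i) (.inl j) = x (.inl i) (.inl j) := by
  have h1 : ξ j ^ 2 - ξ i ^ 2 ≠ 0 := sub_ne_zero.2 fun heq => hij (h.sq_injective heq).symm
  have h2 : ξ i ^ 2 - ξ j ^ 2 = -(ξ j ^ 2 - ξ i ^ 2) := by ring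
  simp only [outCoord, inCoord]
  rw [h2, div_neg]
  field_simp
  ring

/-- The sum of the two candidates differs from Z' only on the diagonal and in the kernel-kernel
block. All tangent matrices vanish there, so the difference is orthogonal to them entry by entry. -/
theorem IsSVD.exists_singularDecomposition (h : IsSVD Z ξ u v) (Z' : Matrix (Fin d) (Fin n) ℝ) :
    ∃ P, IsSingularDecomposition Z Z' P ∧
      (∀ a b, coord u v P.1 a b = outCoord ξ (coord u v Z') a b) ∧
      ∀ a b, coord u v P.2 a b = inCoord ξ (coord u v Z') a b := by
  obtain ⟨A, hA⟩ := exists_coord_eq u v (outCoord ξ (coord u v Z'))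
  obtain ⟨B, hB⟩ := exists_coord_eq u v (inCoord ξ (coord u v Z'))
  have hAo := h.mem_outerTangent hA
  have hBi := h.mem_innerTangent hB
  refine ⟨(A, B), ⟨hAo, hBi, ?_⟩, hA, hB⟩
  rw [rotPart, LinearEquiv.symm_apply_eq]
  refine Submodule.eq_starProjection_of_mem_of_inner_eq_zero
    (Submodule.mem_map_of_mem (Submodule.add_mem_sup hAo hBi)) ?_
  rintro _ ⟨C, hC, rfl⟩
  obtain ⟨C₁, hC₁, C₂, hC₂, rfl⟩ := Submodule.mem_sup.1 hC
  obtain ⟨s, hs, hC₁⟩ := h.mem_outerTangent_iff.1 hC₁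
  obtain ⟨s', hs', hC₂⟩ := h.mem_innerTangent_iff.1 hC₂
  change inner ℝ (frob Z' - frob (A + B)) (frob (C₁ + C₂)) = 0
  rw [← map_sub, inner_frob u v]
  refine Finset.sum_eq_zero fun a _ => Finset.sum_eq_zero fun b _ => mul_eq_zero.2 ?_
  rw [coord_sub, coord_add, coord_add, hA, hB]
  rcases a with i | a <;> rcases b with j | b
  · by_cases hij : i = j
    · subst hij
      right
      have h1 := hs (.inl i) (.inl i)
      have h2 := hs' (.inl i) (.inl i)
      rw [(hC₁ _).1, (hC₂ _).1, show s (.inl i) (.inl i) = 0 by linarith,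
        show s' (.inl i) (.inl i) = 0 by linarith]
      simp
    · left
      rw [h.outCoord_add_inCoord _ hij, sub_self]
  · left
    simp [outCoord, inCoord]
  · left
    simp [outCoord, inCoord]
  · right
    rw [(hC₁ _).2, (hC₂ _).2, add_zero]

theorem IsSVD.existsUnique_singularDecomposition (h : IsSVD Z ξ u v)
    (Z' : Matrix (Fin d) (Fin n) ℝ) : ∃! P, IsSingularDecomposition Z Z' P := by
  obtain ⟨P, hP, -⟩ := h.exists_singularDecomposition Z'
  refine ⟨P, hP, fun Q hQ => ?_⟩
  have hsub : Q.1 - P.1 = P.2 - Q.2 := by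
    rw [sub_eq_sub_iff_add_eq_add, ← hQ.2.2, hP.2.2, add_comm]
  have h0 : Q.1 - P.1 = 0 := Submodule.disjoint_def.1 h.disjoint_tangent _
    (sub_mem hQ.1 hP.1) (hsub ▸ sub_mem hP.2.1 hQ.2.1)
  exact Prod.ext (sub_eq_zero.1 h0) (sub_eq_zero.1 (hsub ▸ h0)).symm

theorem IsSVD.coord_singularDecomposition (h : IsSVD Z ξ u v) (Z' : Matrix (Fin d) (Fin n) ℝ) :
    (∀ a b, coord u v (singularDecomposition Z Z').1 a b = outCoord ξ (coord u v Z') a b) ∧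
      ∀ a b, coord u v (singularDecomposition Z Z').2 a b = inCoord ξ (coord u v Z') a b := by
  obtain ⟨P, hP, hP'⟩ := h.exists_singularDecomposition Z'
  have : singularDecomposition Z Z' = P :=
    (h.existsUnique_singularDecomposition Z').unique (Classical.epsilon_spec ⟨P, hP⟩) hP
  rwa [this]

theorem IsSVD.Eout_eq (h : IsSVD Z ξ u v) (M : ℝ) (Z' : Matrix (Fin d) (Fin n) ℝ) :
    Eout M Z Z' = EoutA M Z Z' + EoutB M Z Z' := by
  rw [Eout, h.EoutA_eq, h.EoutB_eq, norm_frob_sq u v, ← mul_add]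
  simp only [(h.coord_singularDecomposition Z').1, Fintype.sum_sum_type, outCoord]
  congr 1
  simp only [ne_eq, OfNat.ofNat_ne_zero, not_false_eq_true, zero_pow, Finset.sum_const_zero,
    add_zero, mul_pow, Finset.mul_sum]
  -- The norm sums over rows first, the energies over the differentiated eigenvector, which labels
  -- the column.
  congr 1
  · rw [Finset.sum_comm]
    simp only [add_comm]
  · rw [Finset.sum_comm]

theorem IsSVD.Ein_eq (h : IsSVD Z ξ u v) (M : ℝ) (Z' : Matrix (Fin d) (Fin n) ℝ) :
    Ein M Z Z' = EinA M Z Z' + EinB M Z Z' := by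
  rw [Ein, h.EinA_eq, h.EinB_eq, norm_frob_sq u v, ← mul_add]
  simp only [(h.coord_singularDecomposition Z').2, Fintype.sum_sum_type, inCoord]
  simp only [ne_eq, OfNat.ofNat_ne_zero, not_false_eq_true, zero_pow, Finset.sum_const_zero,
    add_zero, mul_pow, Finset.mul_sum, Finset.sum_add_distrib]

/-- The kernel rows and kernel columns of Z', outside the kernel-kernel block, survive unchanged in
Z^rot and occupy disjoint blocks; what is discarded is the squared norm of its k×k block. -/
theorem IsSVD.sum_le_norm_rotPart (h : IsSVD Z ξ u v) (Z' : Matrix (Fin d) (Fin n) ℝ) :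
    ∑ i, ∑ a, coord u v Z' (.inr a) (.inl i) ^ 2 + ∑ i, ∑ b, coord u v Z' (.inl i) (.inr b) ^ 2 ≤
      ‖frob (rotPart Z Z')‖ ^ 2 := by
  obtain ⟨P, hP, hP1, hP2⟩ := h.exists_singularDecomposition Z'
  rw [hP.2.2, norm_frob_sq u v]
  simp only [coord_add, hP1, hP2, Fintype.sum_sum_type, Finset.sum_add_distrib]
  simp only [outCoord, inCoord, add_zero, zero_add, ne_eq, OfNat.ofNat_ne_zero, not_false_eq_true,
    zero_pow, Finset.sum_const_zero]
  rw [Finset.sum_comm (f := fun i a => coord u v Z' (.inr a) (.inl i) ^ 2)]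
  gcongr
  rw [le_add_iff_nonneg_left]
  positivity

theorem IsSVD.EoutB_le_Trot (h : IsSVD Z ξ u v) {M : ℝ} (hM : 0 ≤ M)
    (Z' : Matrix (Fin d) (Fin n) ℝ) : EoutB M Z Z' ≤ Trot M Z Z' := by
  rw [h.EoutB_eq, Trot]
  gcongr
  refine le_trans (le_add_of_nonneg_right ?_) (h.sum_le_norm_rotPart Z')
  positivity

theorem IsSVD.EinB_le_Trot (h : IsSVD Z ξ u v) {M : ℝ} (hM : 0 ≤ M)
    (Z' : Matrix (Fin d) (Fin n) ℝ) : EinB M Z Z' ≤ Trot M Z Z' := by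
  rw [h.EinB_eq, Trot]
  gcongr
  refine le_trans (le_add_of_nonneg_left ?_) (h.sum_le_norm_rotPart Z')
  positivity

end Tangent

/-! ### Rotations and appended zero columns -/

section Invariance

variable {d n k : ℕ} {α β : Type*} [Fintype α] [Fintype β]
  {Z : Matrix (Fin d) (Fin n) ℝ} {ξ : Fin k → ℝ}
  {u : OrthonormalBasis (Fin k ⊕ α) ℝ (EuclideanSpace ℝ (Fin d))}
  {v : OrthonormalBasis (Fin k ⊕ β) ℝ (EuclideanSpace ℝ (Fin n))}

theorem IsSVD.orthogonal (h : IsSVD Z ξ u v) {R : Matrix (Fin d) (Fin d) ℝ}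
    (hR : R ∈ orthogonalGroup (Fin d) ℝ) {Q : Matrix (Fin n) (Fin n) ℝ}
    (hQ : Q ∈ orthogonalGroup (Fin n) ℝ) :
    IsSVD (R * Z * Qᵀ) ξ (u.map (orthogonalIsometry hR)) (v.map (orthogonalIsometry hQ)) := by
  refine ⟨h.pos, h.strictAnti, fun i => ?_, fun b => ?_⟩
  · simp only [OrthonormalBasis.map_apply, orthogonalIsometry_apply, toEuclideanLin_mul,
      transpose_toEuclideanLin_orthogonal hQ, h.apply_inl, map_smul]
  · simp only [OrthonormalBasis.map_apply, orthogonalIsometry_apply, toEuclideanLin_mul,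
      transpose_toEuclideanLin_orthogonal hQ, h.apply_inr, map_zero]

theorem coord_orthogonal {ι κ : Type*} [Fintype ι] [Fintype κ]
    (u : OrthonormalBasis ι ℝ (EuclideanSpace ℝ (Fin d)))
    (v : OrthonormalBasis κ ℝ (EuclideanSpace ℝ (Fin n))) {R : Matrix (Fin d) (Fin d) ℝ}
    (hR : R ∈ orthogonalGroup (Fin d) ℝ) {Q : Matrix (Fin n) (Fin n) ℝ}
    (hQ : Q ∈ orthogonalGroup (Fin n) ℝ) (A : Matrix (Fin d) (Fin n) ℝ) (a : ι) (b : κ) :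
    coord (u.map (orthogonalIsometry hR)) (v.map (orthogonalIsometry hQ)) (R * A * Qᵀ) a b =
      coord u v A a b := by
  simp only [coord, OrthonormalBasis.map_apply, orthogonalIsometry_apply, toEuclideanLin_mul,
    transpose_toEuclideanLin_orthogonal hQ]
  rw [inner_toEuclideanLin_left, transpose_toEuclideanLin_orthogonal hR]

/-- The vector `(x, c)`. -/
noncomputable def snocVec (x : EuclideanSpace ℝ (Fin n)) (c : ℝ) : EuclideanSpace ℝ (Fin (n + 1)) :=
  WithLp.toLp 2 (Fin.snoc (α := fun _ => ℝ) x c)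

theorem inner_snocVec (x y : EuclideanSpace ℝ (Fin n)) (c e : ℝ) :
    inner ℝ (snocVec x c) (snocVec y e) = inner ℝ x y + c * e := by
  simp [snocVec, PiLp.inner_apply, Fin.sum_univ_castSucc, mul_comm]

theorem toEuclideanLin_appendZeroColumn (A : Matrix (Fin d) (Fin n) ℝ)
    (x : EuclideanSpace ℝ (Fin n)) (c : ℝ) :
    toEuclideanLin (appendZeroColumn A) (snocVec x c) = toEuclideanLin A x := by
  ext i
  simp [snocVec, appendZeroColumn, toLpLin_apply, mulVec, dotProduct, Fin.sum_univ_castSucc]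

/-- The new coordinate vector, labelled `none`, is placed among the kernel vectors, since it is
annihilated by (Z 0). -/
theorem exists_snocBasis (v : OrthonormalBasis (Fin k ⊕ β) ℝ (EuclideanSpace ℝ (Fin n))) :
    ∃ v' : OrthonormalBasis (Fin k ⊕ Option β) ℝ (EuclideanSpace ℝ (Fin (n + 1))),
      (∀ i, v' (.inl i) = snocVec (v (.inl i)) 0) ∧
      (∀ b, v' (.inr (some b)) = snocVec (v (.inr b)) 0) ∧ v' (.inr none) = snocVec 0 1 := by
  classical
  let f : Fin k ⊕ Option β → EuclideanSpace ℝ (Fin (n + 1)) :=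
    Sum.elim (fun i => snocVec (v (.inl i)) 0)
      (fun b => b.elim (snocVec 0 1) fun b => snocVec (v (.inr b)) 0)
  have hf : Orthonormal ℝ f := by
    rw [orthonormal_iff_ite]
    rintro (i | _ | b) (j | _ | c) <;>
      simp only [f, Sum.elim_inl, Sum.elim_inr, Option.elim, inner_snocVec] <;>
      simp [v.inner_eq_ite]
  have hcard : Fintype.card (Fin k ⊕ Option β) =
      Module.finrank ℝ (EuclideanSpace ℝ (Fin (n + 1))) := by
    have := Module.finrank_eq_card_basis v.toBasis
    simp only [finrank_euclideanSpace, Fintype.card_fin, Fintype.card_sum] at this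
    simp [this, add_assoc]
  have : Nonempty (Fin k ⊕ Option β) := ⟨.inr none⟩
  let w := OrthonormalBasis.mk hf
    (hf.linearIndependent.span_eq_top_of_card_eq_finrank hcard).ge
  have hw : ∀ a, w a = f a := fun a => by simp [w]
  exact ⟨w, fun i => hw _, fun b => hw _, hw _⟩

theorem IsSVD.append (h : IsSVD Z ξ u v) :
    ∃ v' : OrthonormalBasis (Fin k ⊕ Option β) ℝ (EuclideanSpace ℝ (Fin (n + 1))),
      IsSVD (appendZeroColumn Z) ξ u v' ∧ ∀ (A : Matrix (Fin d) (Fin n) ℝ) a,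
        (∀ i, coord u v' (appendZeroColumn A) a (.inl i) = coord u v A a (.inl i)) ∧
        (∀ b, coord u v' (appendZeroColumn A) a (.inr (some b)) = coord u v A a (.inr b)) ∧
        coord u v' (appendZeroColumn A) a (.inr none) = 0 := by
  obtain ⟨v', h1, h2, h3⟩ := exists_snocBasis v
  refine ⟨v', ⟨h.pos, h.strictAnti, fun i => ?_, fun b => ?_⟩, fun A a =>
    ⟨fun i => ?_, fun b => ?_, ?_⟩⟩
  · rw [h1, toEuclideanLin_appendZeroColumn, h.apply_inl]
  · rcases b with _ | b
    · rw [h3, toEuclideanLin_appendZeroColumn, map_zero]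
    · rw [h2, toEuclideanLin_appendZeroColumn, h.apply_inr]
  · rw [coord, h1, toEuclideanLin_appendZeroColumn, coord]
  · rw [coord, h2, toEuclideanLin_appendZeroColumn, coord]
  · rw [coord, h3, toEuclideanLin_appendZeroColumn, map_zero, inner_zero_right]

/-- A function of the singular values and of the entries of the velocity with respect to the
singular vectors, unchanged by the extension of the entries by a zero column, is an instantaneous
phase-space invariant. -/
theorem isInstantaneousPhaseSpaceInvariant_of_coord (d n₀ : ℕ)
    (f : ∀ n : ℕ, Matrix (Fin d) (Fin n) ℝ → Matrix (Fin d) (Fin n) ℝ → ℝ)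
    (F : ∀ (k : ℕ) (α β : Type) [Fintype α] [Fintype β], (Fin k → ℝ) →
      (Fin k ⊕ α → Fin k ⊕ β → ℝ) → ℝ)
    (hF : ∀ (n k : ℕ) (α β : Type) [Fintype α] [Fintype β] (Z Z' : Matrix (Fin d) (Fin n) ℝ)
      (ξ : Fin k → ℝ) (u : OrthonormalBasis (Fin k ⊕ α) ℝ (EuclideanSpace ℝ (Fin d)))
      (v : OrthonormalBasis (Fin k ⊕ β) ℝ (EuclideanSpace ℝ (Fin n))),
      IsSVD Z ξ u v → f n Z Z' = F k α β ξ (coord u v Z'))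
    (hzero : ∀ (k : ℕ) (α β : Type) [Fintype α] [Fintype β] (ξ : Fin k → ℝ)
      (x : Fin k ⊕ α → Fin k ⊕ β → ℝ) (y : Fin k ⊕ α → Fin k ⊕ Option β → ℝ),
      (∀ a, (∀ i, y a (.inl i) = x a (.inl i)) ∧ (∀ b, y a (.inr (some b)) = x a (.inr b)) ∧
        y a (.inr none) = 0) → F k α (Option β) ξ y = F k α β ξ x) :
    IsInstantaneousPhaseSpaceInvariant d n₀ (distinctDomain d) f where
  orthogonal_mem n _ Z hZ R hR Q hQ := by
    obtain ⟨u, v, h⟩ := exists_isSVD hZ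
    exact (h.orthogonal hR hQ).mem_distinctDomain
  orthogonal_eq n _ Z hZ Z' R hR Q hQ := by
    obtain ⟨u, v, h⟩ := exists_isSVD hZ
    rw [hF _ _ _ _ _ _ _ _ _ h, hF _ _ _ _ _ _ _ _ _ (h.orthogonal hR hQ)]
    congr 1
    funext a b
    exact coord_orthogonal u v hR hQ Z' a b
  append_mem n _ Z hZ := by
    obtain ⟨u, v, h⟩ := exists_isSVD hZ
    obtain ⟨v', h', -⟩ := h.append
    exact h'.mem_distinctDomain
  append_eq n _ Z hZ Z' := by
    obtain ⟨u, v, h⟩ := exists_isSVD hZ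
    obtain ⟨v', h', hcoord⟩ := h.append
    rw [hF _ _ _ _ _ _ _ _ _ h, hF _ _ _ _ _ _ _ _ _ h']
    exact hzero _ _ _ _ _ _ (hcoord Z')

end Invariance

end PhaseSpace

/-! ### The main theorem -/

open PhaseSpace
theorem theorem8 (d : ℕ) (hd : 1 ≤ d) (M : ℝ) (hM : 0 < M) :
    (∀ n : ℕ, 1 ≤ n → ∀ Z ∈ distinctDomain d n, ∀ Z' : Matrix (Fin d) (Fin n) ℝ,
      EnergiesWellDefined M Z Z') ∧
    IsInstantaneousPhaseSpaceInvariant d 1 (distinctDomain d) (fun _ Z Z' => EoutA M Z Z') ∧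
    IsInstantaneousPhaseSpaceInvariant d 1 (distinctDomain d) (fun _ Z Z' => EoutB M Z Z') ∧
    IsInstantaneousPhaseSpaceInvariant d 1 (distinctDomain d) (fun _ Z Z' => EinA M Z Z') ∧
    IsInstantaneousPhaseSpaceInvariant d 1 (distinctDomain d) (fun _ Z Z' => EinB M Z Z') ∧
    (∀ n : ℕ, 1 ≤ n → ∀ Z ∈ distinctDomain d n, ∀ Z' : Matrix (Fin d) (Fin n) ℝ,
      Eout M Z Z' = EoutA M Z Z' + EoutB M Z Z' ∧
      Ein M Z Z' = EinA M Z Z' + EinB M Z Z' ∧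
      EoutB M Z Z' ≤ Trot M Z Z' ∧
      EinB M Z Z' ≤ Trot M Z Z') := by
  refine ⟨fun n _ Z hZ Z' => ?_, ?_, ?_, ?_, ?_, fun n _ Z hZ Z' => ?_⟩
  · obtain ⟨u, v, h⟩ := exists_isSVD hZ
    exact energiesWellDefined M hZ Z' (h.existsUnique_singularDecomposition Z')
  · refine isInstantaneousPhaseSpaceInvariant_of_coord d 1 _
      (fun k α β _ _ ξ x => M / 2 * ∑ i, ξ i ^ 2 * ∑ j, ((ξ j * x (.inl i) (.inl j) +
        ξ i * x (.inl j) (.inl i)) / (ξ i ^ 2 - ξ j ^ 2)) ^ 2)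
      (fun n k α β _ _ Z Z' ξ u v h => h.EoutA_eq M Z') fun k α β _ _ ξ x y hxy => ?_
    simp only [(hxy _).1]
  · refine isInstantaneousPhaseSpaceInvariant_of_coord d 1 _
      (fun k α β _ _ ξ x => M / 2 * ∑ i, ∑ a, x (.inr a) (.inl i) ^ 2)
      (fun n k α β _ _ Z Z' ξ u v h => h.EoutB_eq M Z') fun k α β _ _ ξ x y hxy => ?_
    simp only [(hxy _).1]
  · refine isInstantaneousPhaseSpaceInvariant_of_coord d 1 _
      (fun k α β _ _ ξ x => M / 2 * ∑ i, ξ i ^ 2 * ∑ j, ((ξ j * x (.inl j) (.inl i) +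
        ξ i * x (.inl i) (.inl j)) / (ξ i ^ 2 - ξ j ^ 2)) ^ 2)
      (fun n k α β _ _ Z Z' ξ u v h => h.EinA_eq M Z') fun k α β _ _ ξ x y hxy => ?_
    simp only [(hxy _).1]
  · refine isInstantaneousPhaseSpaceInvariant_of_coord d 1 _
      (fun k α β _ _ ξ x => M / 2 * ∑ i, ∑ b, x (.inl i) (.inr b) ^ 2)
      (fun n k α β _ _ Z Z' ξ u v h => h.EinB_eq M Z') fun k α β _ _ ξ x y hxy => ?_
    -- Of the four energies only this one sums over the kernel of Z, so the appended column
    -- contributes an extra term, which is zero.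
    simp [Fintype.sum_option, (hxy _).2.1, (hxy _).2.2]
  · obtain ⟨u, v, h⟩ := exists_isSVD hZ
    exact ⟨h.Eout_eq M Z', h.Ein_eq M Z', h.EoutB_le_Trot hM.le Z', h.EinB_le_Trot hM.le Z'⟩
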